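/- Let $m\ge 1$, let $\Sigma=\{1,\dots,m\}^{\mathbb N}$ be the (one-sided) full shift on $m$ symbols with the product topology, and let $\sigma:\Sigma\to\Sigma$ be the left shift. Let $f:\Sigma\to\mathbb R$ be a continuous function that is not cohomologous to a constant, in the following sense appropriate to continuous functions: there is no constant $c\in\mathbb R$ such that $f-c$ is a uniform limit of coboundaries $u\circ\sigma-u$ with $u:\Sigma\to\mathbb R$ continuous. For $x\in\Sigma$ and $n\ge 1$ put $$H^{(0)}_n(x)=B_n(x)=\frac1n\sum_{i=0}^{n-1}f(\sigma^i x),\qquad H^{(k)}_n(x)=\frac1n\sum_{i=1}^{n}H^{(k-1)}_i(x)\quad(k\ge1),$$ and let $L_k(x)\subset\mathbb R$ be the set of limits of subsequences of $(H^{(k)}_n(x))_{n\ge1}$. The Birkhoff averages of $f$ at $x$ are of type B2 if $(B_n(x))$ diverges and $\bigcap_{k\ge1}L_k(x)$ is a non-trivial interval $[a,b]$, $a<b$. Then the set of all $x\in\Sigma$ at which the Birkhoff averages of $f$ are of type B2 has topological entropy $$h\bigl(\sigma,\{x\in\Sigma: x\text{ is of type B2}\}\bigr)=\log m .$$ Here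 $h(\sigma,Y)$ is Bowen's topological entropy of a (not necessarily compact) set $Y\subset\Sigma$: for a finite open cover $\mathcal A$ of $\Sigma$ and $E\subset\Sigma$, let $n_{\mathcal A}(E)\in\mathbb N\cup\{\infty\}$ be the largest $n$ such that for each $0\le k<n$ the set $\sigma^kE$ is contained in an element of $\mathcal A$, and put $D_{\mathcal A}(E)=e^{-n_{\mathcal A}(E)}$. For $s>0$ let $$m_{\mathcal A,s}(Y)=\lim_{\varepsilon\to0}\ \inf\Bigl\{\sum_{E\in\mathcal C}D_{\mathcal A}(E)^s:\ \mathcal C\text{ a countable cover of }Y,\ D_{\mathcal A}(E)<\varepsilon\ \text{for all } E\in\mathcal C\Bigr\},$$ $h_{\mathcal A}(\sigma,Y)=\inf\{s>0: m_{\mathcal A,s}(Y)=0\}$, and $h(\sigma,Y)=\sup_{\mathcal A}h_{\mathcal A}(\sigma,Y)$. -/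

import Mathlib

open Filter Topology Set
open scoped ENNReal

noncomputable section

/-- The left shift on one-sided sequences over an alphabet `A`. -/
def leftShift {A : Type*} (x : ℕ → A) : ℕ → A := fun n => x (n + 1)

/-- `f` is cohomologous to a constant: for some real `c`, the function `f - c` is a uniform limit
of coboundaries `u ∘ T - u` with `u` continuous. -/
def CohomologousToConst {X : Type*} [TopologicalSpace X] (T : X → X) (f : X → ℝ) : Prop :=
  ∃ c : ℝ, ∀ ε > 0, ∃ u : C(X, ℝ), ∀ x, |f x - c - (u (T x) - u x)| < ε

/-- The `k`-th order Hölder mean `H^{(k)}_n` of the Birkhoff averages of `f` along the orbit of `x`: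
`H^{(0)}_n = (1/n) ∑_{i=0}^{n-1} f (T^i x)` and `H^{(k+1)}_n = (1/n) ∑_{i=1}^n H^{(k)}_i`.
Only the values at `n ≥ 1` matter. -/
def holderMean {X : Type*} (T : X → X) (f : X → ℝ) (x : X) : ℕ → ℕ → ℝ
  | 0, n => birkhoffAverage ℝ T f n x
  | k + 1, n => (1 / (n : ℝ)) * ∑ i ∈ Finset.Icc 1 n, holderMean T f x k i

/-- The limit set of a real sequence: the set of limits of its subsequences. -/
def limitSet (a : ℕ → ℝ) : Set ℝ := {y | MapClusterPt y atTop a}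

/-- The Birkhoff averages of `f` at `x` are of type B2: they diverge, and the intersection over
`k ≥ 1` of the limit sets of the `k`-th order averages is an interval `[a, b]` with `a < b`. -/
def IsTypeB2 {X : Type*} (T : X → X) (f : X → ℝ) (x : X) : Prop :=
  (¬ ∃ l : ℝ, Tendsto (fun n => birkhoffAverage ℝ T f n x) atTop (𝓝 l)) ∧
  ∃ a b : ℝ, a < b ∧ ⋂ k ≥ 1, limitSet (holderMean T f x k) = Icc a b

/-- A finite open cover of `X`. -/
def IsFiniteOpenCover {X : Type*} [TopologicalSpace X] (𝒜 : Set (Set X)) : Prop :=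
  𝒜.Finite ∧ (∀ U ∈ 𝒜, IsOpen U) ∧ ⋃₀ 𝒜 = univ

/-- `n_𝒜(E)`: the largest `n` (possibly `∞`) such that, for all `0 ≤ k < n`,
the image `T^k E` is contained in some element of `𝒜`. -/
def coverTime {X : Type*} (T : X → X) (𝒜 : Set (Set X)) (E : Set X) : ℕ∞ :=
  sSup {n : ℕ∞ | ∀ k : ℕ, (k : ℕ∞) < n → ∃ U ∈ 𝒜, T^[k] '' E ⊆ U}

/-- `D_𝒜(E) = exp (-n_𝒜(E))`, which is `0` if `n_𝒜(E) = ∞`. -/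
def coverSize {X : Type*} (T : X → X) (𝒜 : Set (Set X)) (E : Set X) : ℝ≥0∞ :=
  EReal.exp (-(((coverTime T 𝒜 E : ℕ∞) : ℝ≥0∞) : EReal))

/-- Bowen's outer measure `m_{𝒜,s}(Y)`: the limit as `ε → 0` (a supremum, by monotonicity) of the
infimum of `∑_{E ∈ 𝒞} D_𝒜(E)^s` over the countable covers `𝒞` of `Y` by sets with
`D_𝒜(E) < ε`. -/
def bowenMeasure {X : Type*} (T : X → X) (𝒜 : Set (Set X)) (s : ℝ) (Y : Set X) : ℝ≥0∞ :=
  ⨆ (ε : ℝ≥0∞) (_ : 0 < ε),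
    ⨅ (𝒞 : Set (Set X)) (_ : 𝒞.Countable) (_ : Y ⊆ ⋃₀ 𝒞) (_ : ∀ E ∈ 𝒞, coverSize T 𝒜 E < ε),
      ∑' E : 𝒞, coverSize T 𝒜 (E : Set X) ^ s

/-- `h_𝒜(T, Y) = inf {s > 0 : m_{𝒜,s}(Y) = 0}`. -/
def bowenEntropyCover {X : Type*} (T : X → X) (𝒜 : Set (Set X)) (Y : Set X) : EReal :=
  ⨅ (s : ℝ) (_ : 0 < s) (_ : bowenMeasure T 𝒜 s Y = 0), (s : EReal)

/-- Bowen's topological entropy `h(T, Y)` of a subset `Y`, not necessarily compact or invariant: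
the supremum of `h_𝒜(T, Y)` over all finite open covers `𝒜` of `X`. -/
def bowenEntropy {X : Type*} [TopologicalSpace X] (T : X → X) (Y : Set X) : EReal :=
  ⨆ (𝒜 : Set (Set X)) (_ : IsFiniteOpenCover 𝒜), bowenEntropyCover T 𝒜 Y

end

/-! The upper bound holds for every subset of the shift, since there are at most `m ^ n` cylinders
of length `n`. For the lower bound, given `s < log m`, the uniform Bernoulli measure is carried into
the B2 set by a map that rewrites only a small proportion of coordinates, and the mass distribution
principle (`bowenMeasure_ne_zero_of_cylinder_le`) applies.

Let `c` be the Bernoulli integral of `f`. Since `f - c` is not a uniform limit of coboundaries, the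
Birkhoff averages do not tend uniformly to `c`: for some `η > 0` there are arbitrarily large `l` and
points `z` with `|B_l(z) - c| ≥ η`. Cut the integers into blocks of length `p = l * K`. In every
block whose index `q` satisfies `2^(2^j) ≤ q < 2^(2^(j+1))` with `j` even, overwrite the first `l`
symbols by those of `z`. The expected block mean is then near `c` for odd `j` and near `c + (B_l(z)
- c) / K` for even `j`, and a strong law (`ae_tendsto_birkhoffAverage_overwrite`) makes the Birkhoff
averages follow these expectations almost surely.

The ratio of consecutive window ends tends to infinity, so any number of further averagings forgets
the earlier windows (`WindowBound.cesaro`), and all Hölder means oscillate across one common gap.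
This forces type B2. The rewritten coordinates have density at most `1 / K`, so a cylinder of length
`n` gets mass at most a constant times `exp (-s n)` once `s ≤ (1 - 1/K) log m`. -/

open MeasureTheory ProbabilityTheory

/-! ### Iterated Cesàro means and limit sets. -/

/-- The Cesàro means `(1/n) ∑_{i=1}^n x_i` of a real sequence. -/
noncomputable def cesaro (x : ℕ → ℝ) (n : ℕ) : ℝ := (1 / (n : ℝ)) * ∑ i ∈ Finset.Icc 1 n, x i

theorem holderMean_eq_iterate_cesaro {X : Type*} (T : X → X) (f : X → ℝ) (x : X) (k : ℕ) :
    holderMean T f x k = cesaro^[k] (fun n => birkhoffAverage ℝ T f n x) := by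
  induction k with
  | zero => funext n; simp [holderMean]
  | succ k ih =>
    rw [Function.iterate_succ_apply', ← ih]
    funext n
    simp [holderMean, cesaro]

theorem cesaro_neg (x : ℕ → ℝ) : cesaro (-x) = -cesaro x := by
  funext n; simp [cesaro]

theorem cesaro_sub (x y : ℕ → ℝ) : cesaro (x - y) = cesaro x - cesaro y := by
  funext n; simp [cesaro, mul_sub]

theorem iterate_cesaro_neg (x : ℕ → ℝ) (k : ℕ) : cesaro^[k] (-x) = -cesaro^[k] x := by
  induction k with
  | zero => rfl
  | succ k ih => rw [Function.iterate_succ_apply', ih, cesaro_neg, Function.iterate_succ_apply']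

theorem iterate_cesaro_sub (x y : ℕ → ℝ) (k : ℕ) :
    cesaro^[k] (x - y) = cesaro^[k] x - cesaro^[k] y := by
  induction k with
  | zero => rfl
  | succ k ih => simp only [Function.iterate_succ_apply', ih, cesaro_sub]

theorem abs_cesaro_le {x : ℕ → ℝ} {M : ℝ} (h : ∀ n, |x n| ≤ M) (n : ℕ) : |cesaro x n| ≤ M := by
  have hM : 0 ≤ M := (abs_nonneg _).trans (h 0)
  rcases Nat.eq_zero_or_pos n with rfl | hn
  · simpa [cesaro] using hM
  have hn' : (0 : ℝ) < n := by exact_mod_cast hn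
  rw [cesaro, abs_mul, abs_of_pos (by positivity), one_div, inv_mul_le_iff₀ hn']
  calc |∑ i ∈ Finset.Icc 1 n, x i| ≤ ∑ i ∈ Finset.Icc 1 n, |x i| := Finset.abs_sum_le_sum_abs _ _
    _ ≤ ∑ i ∈ Finset.Icc 1 n, M := Finset.sum_le_sum fun i _ => h i
    _ = n * M := by simp

theorem abs_iterate_cesaro_le {x : ℕ → ℝ} {M : ℝ} (h : ∀ n, |x n| ≤ M) (k n : ℕ) :
    |cesaro^[k] x n| ≤ M := by
  induction k generalizing n with
  | zero => exact h n
  | succ k ih => rw [Function.iterate_succ_apply']; exact abs_cesaro_le ih n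

theorem tendsto_cesaro {x : ℕ → ℝ} {l : ℝ} (h : Tendsto x atTop (𝓝 l)) :
    Tendsto (cesaro x) atTop (𝓝 l) := by
  have := ((tendsto_add_atTop_iff_nat 1).2 h).cesaro
  refine this.congr fun n => ?_
  rw [cesaro, one_div, Finset.range_eq_Ico, Finset.sum_Ico_add' (fun i => x i) 0 n 1]
  rfl

theorem tendsto_iterate_cesaro {x : ℕ → ℝ} {l : ℝ} (h : Tendsto x atTop (𝓝 l)) (k : ℕ) :
    Tendsto (cesaro^[k] x) atTop (𝓝 l) := by
  induction k with
  | zero => exact h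
  | succ k ih => rw [Function.iterate_succ_apply']; exact tendsto_cesaro ih

theorem tendsto_cesaro_succ_sub {x : ℕ → ℝ} {M : ℝ} (h : ∀ n, |x n| ≤ M) :
    Tendsto (fun n => cesaro x (n + 1) - cesaro x n) atTop (𝓝 0) := by
  have key : ∀ n : ℕ, |cesaro x (n + 1) - cesaro x n| ≤ 2 * M * (1 / ((n : ℝ) + 1)) := by
    intro n
    have h1 : ((n + 1 : ℕ) : ℝ) * cesaro x (n + 1) = n * cesaro x n + x (n + 1) := by
      rcases Nat.eq_zero_or_pos n with rfl | hn
      · simp [cesaro]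
      · have hn' : (n : ℝ) ≠ 0 := by positivity
        have hn'' : ((n + 1 : ℕ) : ℝ) ≠ 0 := by positivity
        rw [cesaro, cesaro, ← mul_assoc, ← mul_assoc, mul_one_div_cancel hn',
          mul_one_div_cancel hn'', one_mul, one_mul, Finset.sum_Icc_succ_top (by lia)]
    have h2 : cesaro x (n + 1) - cesaro x n = (x (n + 1) - cesaro x n) * (1 / ((n : ℝ) + 1)) := by
      push_cast at h1
      field_simp
      linarith
    rw [h2, abs_mul, abs_of_pos (a := 1 / ((n : ℝ) + 1)) (by positivity)]
    gcongr
    have := abs_sub (x (n + 1)) (cesaro x n)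
    linarith [h (n + 1), abs_cesaro_le h n]
  refine squeeze_zero_norm key ?_
  simpa using (tendsto_one_div_add_atTop_nhds_zero_nat (𝕜 := ℝ)).const_mul (2 * M)

/-- A discrete intermediate value argument: at the first passage above `y` after a term below it,
the preceding term is within one small increment of `y`. -/
theorem mem_limitSet_of_frequently {x : ℕ → ℝ} {y : ℝ}
    (hx : Tendsto (fun n => x (n + 1) - x n) atTop (𝓝 0))
    (hlo : ∃ᶠ n in atTop, x n ≤ y) (hhi : ∃ᶠ n in atTop, y ≤ x n) : y ∈ limitSet x := by
  refine mapClusterPt_iff_frequently.2 fun s hs => ?_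
  obtain ⟨ε, hε, hs⟩ := Metric.mem_nhds_iff.1 hs
  rw [frequently_atTop]
  intro N
  obtain ⟨N', hN'⟩ := eventually_atTop.1 (Metric.tendsto_nhds.1 hx ε hε)
  obtain ⟨n₁, hn₁, h₁⟩ := frequently_atTop.1 hlo (max N N')
  obtain ⟨n₂, hn₂, h₂⟩ := frequently_atTop.1 hhi (n₁ + 1)
  have hex : ∃ j, y ≤ x (n₁ + 1 + j) := ⟨n₂ - (n₁ + 1), by rwa [Nat.add_sub_cancel' hn₂]⟩
  classical
  set j := Nat.find hex
  have hj : y ≤ x (n₁ + 1 + j) := Nat.find_spec hex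
  have hj' : x (n₁ + j) ≤ y := by
    rcases Nat.eq_zero_or_pos j with h0 | h0
    · simpa [h0] using h₁
    · have := Nat.find_min hex (m := j - 1) (by lia)
      rw [show n₁ + 1 + (j - 1) = n₁ + j by lia] at this
      exact (not_le.1 this).le
  refine ⟨n₁ + j, by lia, hs ?_⟩
  have := hN' (n₁ + j) (by lia)
  rw [Real.dist_eq, sub_zero, show n₁ + j + 1 = n₁ + 1 + j by lia] at this
  rw [Metric.mem_ball, Real.dist_eq]
  rw [abs_lt] at *
  constructor <;> linarith

theorem isClosed_limitSet (x : ℕ → ℝ) : IsClosed (limitSet x) := isClosed_setOfPred_clusterPt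

theorem limitSet_subset_Icc {x : ℕ → ℝ} {M : ℝ} (h : ∀ n, |x n| ≤ M) :
    limitSet x ⊆ Icc (-M) M := fun _ hy =>
  isClosed_Icc.mem_of_mapClusterPt hy (Eventually.of_forall fun n => abs_le.1 (h n))

theorem ordConnected_limitSet {x : ℕ → ℝ}
    (hx : Tendsto (fun n => x (n + 1) - x n) atTop (𝓝 0)) : (limitSet x).OrdConnected := by
  refine ordConnected_of_Ioo fun a ha b hb _ y hy => mem_limitSet_of_frequently hx ?_ ?_
  · exact (mapClusterPt_iff_frequently.1 ha _ (Iic_mem_nhds hy.1))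
  · exact (mapClusterPt_iff_frequently.1 hb _ (Ici_mem_nhds hy.2))

/-- Each mean of order `k ≥ 1` is bounded with vanishing increments, so its limit set is a compact
interval; all of these contain `[α, β]`, hence so does their intersection. The case `k = 0` only
serves to give divergence. -/
theorem isTypeB2_of_frequently {X : Type*} {T : X → X} {f : X → ℝ} {x : X} {M α β : ℝ}
    (hM : ∀ n, |birkhoffAverage ℝ T f n x| ≤ M) (hαβ : α < β)
    (hlo : ∀ k, ∃ᶠ n in atTop, cesaro^[k] (fun n => birkhoffAverage ℝ T f n x) n ≤ α)
    (hhi : ∀ k, ∃ᶠ n in atTop, β ≤ cesaro^[k] (fun n => birkhoffAverage ℝ T f n x) n) :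
    IsTypeB2 T f x := by
  set B := fun n => birkhoffAverage ℝ T f n x with hB
  refine ⟨?_, ?_⟩
  · rintro ⟨l, hl⟩
    have h1 : l ≤ α := le_of_not_gt fun h => (hlo 0) <| by
      filter_upwards [hl.eventually_const_lt h] with n hn using not_le.2 hn
    have h2 : β ≤ l := le_of_not_gt fun h => (hhi 0) <| by
      filter_upwards [hl.eventually_lt_const h] with n hn using not_le.2 hn
    linarith
  set S := ⋂ k ≥ 1, limitSet (holderMean T f x k) with hS
  have hdiff : ∀ k ≥ 1, Tendsto (fun n => holderMean T f x k (n + 1) - holderMean T f x k n)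
      atTop (𝓝 0) := by
    intro k hk
    obtain ⟨k, rfl⟩ := Nat.exists_eq_add_of_le' hk
    rw [holderMean_eq_iterate_cesaro, Function.iterate_succ_apply']
    exact tendsto_cesaro_succ_sub (abs_iterate_cesaro_le hM k)
  have hclosed : IsClosed S := isClosed_biInter fun k _ => isClosed_limitSet _
  have hord : S.OrdConnected :=
    ordConnected_iInter fun k => ordConnected_iInter fun hk => ordConnected_limitSet (hdiff k hk)
  have hmem : ∀ y ∈ Icc α β, y ∈ S := by
    intro y hy
    refine mem_iInter₂.2 fun k hk => mem_limitSet_of_frequently (hdiff k hk) ?_ ?_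
    · rw [holderMean_eq_iterate_cesaro]; exact (hlo k).mono fun n hn => hn.trans hy.1
    · rw [holderMean_eq_iterate_cesaro]; exact (hhi k).mono fun n hn => hy.2.trans hn
  have hα : α ∈ S := hmem α ⟨le_rfl, hαβ.le⟩
  have hβ : β ∈ S := hmem β ⟨hαβ.le, le_rfl⟩
  have hsub : S ⊆ Icc (-M) M := by
    refine (biInter_subset_of_mem (show 1 ∈ {k : ℕ | k ≥ 1} from le_refl 1)).trans ?_
    refine limitSet_subset_Icc fun n => ?_
    rw [holderMean_eq_iterate_cesaro]
    exact abs_iterate_cesaro_le hM 1 n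
  have hcpt : IsCompact S := isCompact_Icc.of_isClosed_subset hclosed hsub
  refine ⟨sInf S, sSup S, ?_, Subset.antisymm ?_ ?_⟩
  · exact (csInf_le hcpt.bddBelow hα).trans_lt (hαβ.trans_le (le_csSup hcpt.bddAbove hβ))
  · exact fun y hy => ⟨csInf_le hcpt.bddBelow hy, le_csSup hcpt.bddAbove hy⟩
  · exact hord.out (hcpt.sInf_mem ⟨α, hα⟩) (hcpt.sSup_mem ⟨α, hα⟩)

/-! ### Bounds on long windows, stable under averaging. -/

/-- A bound on `x` valid on windows `[K N_j, N_{j+1}]` for `j ∈ J` and every margin `δ`. -/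
def WindowBound (N : ℕ → ℕ) (J : Set ℕ) (α : ℝ) (x : ℕ → ℝ) : Prop :=
  ∀ δ > 0, ∃ K : ℝ, ∀ j ∈ J, ∀ n : ℕ, K * N j ≤ n → n ≤ N (j + 1) → x n ≤ α + δ

/-- The terms before `K * N j` add at most a multiple of `N j` to the sum, which is negligible
against `n` once `n` is a large multiple of `N j`. Averaging thus moves the left end by a constant
factor and keeps the right end. -/
theorem WindowBound.cesaro {N : ℕ → ℕ} {J : Set ℕ} {α M : ℝ} {x : ℕ → ℝ} (hN : ∀ j, 1 ≤ N j)
    (hM : ∀ n, |x n| ≤ M) (h : WindowBound N J α x) : WindowBound N J α (cesaro x) := by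
  intro δ hδ
  obtain ⟨K, hK⟩ := h (δ / 2) (by positivity)
  have hM0 : 0 ≤ M := (abs_nonneg _).trans (hM 0)
  set K₁ := max K 0 with hK₁
  have hK₁0 : 0 ≤ K₁ := le_max_right _ _
  set D := M + |α| with hD
  have hD0 : 0 ≤ D := by positivity
  refine ⟨K₁ * D / (δ / 2) + 1, fun j hj n hn hn' => ?_⟩
  have hNj : (1 : ℝ) ≤ N j := by exact_mod_cast hN j
  have hKD : 0 ≤ K₁ * D / (δ / 2) := by positivity
  have hn0 : (0 : ℝ) < n := by nlinarith
  have hsum : ∑ i ∈ Finset.Icc 1 n, (x i - (α + δ / 2)) ≤ K₁ * N j * D := by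
    have hle : ∀ i ∈ Finset.Icc 1 n, x i - (α + δ / 2) ≤
        if i ∈ Finset.Icc 1 ⌊K₁ * N j⌋₊ then D else 0 := by
      intro i hi
      have hi' := Finset.mem_Icc.1 hi
      split_ifs with hc
      · have := abs_le.1 (hM i); have := neg_abs_le α; linarith
      · have h1 : K₁ * N j < i := by
          rw [Finset.mem_Icc, not_and_or, not_le, not_le] at hc
          rcases hc with hc | hc
          · lia
          · exact (Nat.floor_lt (by positivity)).1 hc
        have := hK j hj i ((mul_le_mul_of_nonneg_right (le_max_left _ _) (by positivity)).trans
          h1.le) (by lia)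
        linarith
    refine (Finset.sum_le_sum hle).trans ?_
    rw [← Finset.sum_filter]
    calc ∑ i ∈ (Finset.Icc 1 n).filter (· ∈ Finset.Icc 1 ⌊K₁ * N j⌋₊), D
        ≤ ∑ i ∈ Finset.Icc 1 ⌊K₁ * N j⌋₊, D :=
          Finset.sum_le_sum_of_subset_of_nonneg (fun i hi => (Finset.mem_filter.1 hi).2)
            fun _ _ _ => hD0
      _ = ⌊K₁ * N j⌋₊ * D := by simp
      _ ≤ K₁ * N j * D := by gcongr; exact Nat.floor_le (by positivity)
  rw [Finset.sum_sub_distrib] at hsum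
  simp only [Finset.sum_const, Nat.card_Icc, Nat.add_sub_cancel, nsmul_eq_mul] at hsum
  rw [_root_.cesaro, one_div, inv_mul_le_iff₀ hn0]
  have h3 : K₁ * D * N j ≤ δ / 2 * n := by
    have : K₁ * D / (δ / 2) * N j ≤ n := by nlinarith
    calc K₁ * D * N j = δ / 2 * (K₁ * D / (δ / 2) * N j) := by field_simp
      _ ≤ δ / 2 * n := by gcongr
  linarith

theorem WindowBound.iterate_cesaro {N : ℕ → ℕ} {J : Set ℕ} {α M : ℝ} {x : ℕ → ℝ}
    (hN : ∀ j, 1 ≤ N j) (hM : ∀ n, |x n| ≤ M) (h : WindowBound N J α x) (k : ℕ) :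
    WindowBound N J α (_root_.cesaro^[k] x) := by
  induction k with
  | zero => exact h
  | succ k ih =>
    rw [Function.iterate_succ_apply']
    exact ih.cesaro hN (abs_iterate_cesaro_le hM k)

theorem WindowBound.frequently_le {N : ℕ → ℕ} {J : Set ℕ} {α : ℝ} {x : ℕ → ℝ}
    (hN : StrictMono N) (hN' : ∀ K : ℝ, ∀ᶠ j in atTop, K * N j ≤ N (j + 1)) (hJ : J.Infinite)
    (h : WindowBound N J α x) {α' : ℝ} (hα : α < α') : ∃ᶠ n in atTop, x n ≤ α' := by
  obtain ⟨K, hK⟩ := h (α' - α) (by linarith)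
  rw [frequently_atTop]
  intro n
  obtain ⟨j₀, hj₀⟩ := eventually_atTop.1 (hN' K)
  obtain ⟨j, hj, hjn⟩ := hJ.exists_gt (max n j₀)
  refine ⟨N (j + 1), ?_, ?_⟩
  · have := hN.id_le (j + 1); simp only [id] at this; lia
  · have := hK j hj (N (j + 1)) (hj₀ j (by lia)) le_rfl
    linarith

/-- The averages `(1/n) ∑_{i<n} e_i`. -/
noncomputable def runningMean (e : ℕ → ℝ) (n : ℕ) : ℝ := (n : ℝ)⁻¹ * ∑ i ∈ Finset.range n, e i

theorem abs_runningMean_le {e : ℕ → ℝ} {M : ℝ} (h : ∀ n, |e n| ≤ M) (n : ℕ) :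
    |runningMean e n| ≤ M := by
  have hM : 0 ≤ M := (abs_nonneg _).trans (h 0)
  rcases Nat.eq_zero_or_pos n with rfl | hn
  · simpa [runningMean] using hM
  have hn' : (0 : ℝ) < n := by exact_mod_cast hn
  rw [runningMean, abs_mul, abs_of_pos (by positivity), inv_mul_le_iff₀ hn']
  calc |∑ i ∈ Finset.range n, e i| ≤ ∑ i ∈ Finset.range n, |e i| := Finset.abs_sum_le_sum_abs _ _
    _ ≤ ∑ i ∈ Finset.range n, M := Finset.sum_le_sum fun i _ => h i
    _ = n * M := by simp

theorem sum_range_mul_period (e : ℕ → ℝ) (p a b : ℕ) (hab : a ≤ b) :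
    ∑ i ∈ Finset.range (p * b), e i = ∑ i ∈ Finset.range (p * a), e i +
      ∑ q ∈ Finset.Ico a b, ∑ i ∈ Finset.range p, e (p * q + i) := by
  induction b, hab using Nat.le_induction with
  | base => simp
  | succ b hb ih =>
    rw [Finset.sum_Ico_succ_top hb, ← add_assoc, ← ih, Nat.mul_succ, Finset.sum_range_add]

theorem windowBound_runningMean {T : ℕ → ℕ} {J : Set ℕ} {p : ℕ} (hp : 1 ≤ p) {e : ℕ → ℝ} {α M : ℝ}
    (hT : ∀ j, 1 ≤ T j) (hM : ∀ n, |e n| ≤ M)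
    (h : ∀ j ∈ J, ∀ q, T j ≤ q → q < T (j + 1) → ∑ i ∈ Finset.range p, e (p * q + i) ≤ p * α) :
    WindowBound (fun j => p * T j) J α (runningMean e) := by
  intro δ hδ
  have hM0 : 0 ≤ M := (abs_nonneg _).trans (hM 0)
  set D := M + |α| with hD
  have hD0 : 0 ≤ D := by positivity
  -- Two errors, the part before the window and the incomplete last block, are each at most `p * T j
  -- * D`; the `+ 1` gives `n ≥ p * T j`.
  refine ⟨2 * D / δ + 1, fun j hj n hn hn' => ?_⟩
  have hp0 : (0 : ℝ) < p := by exact_mod_cast hp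
  have hN1 : p ≤ p * T j := Nat.le_mul_of_pos_right _ (hT j)
  have hN1' : (p : ℝ) ≤ (p * T j : ℕ) := by exact_mod_cast hN1
  have hDd : 0 ≤ 2 * D / δ := by positivity
  have hnN : ((p * T j : ℕ) : ℝ) ≤ n := by nlinarith
  have hn0 : (0 : ℝ) < n := by linarith
  have hnN' : p * T j ≤ n := by exact_mod_cast hnN
  set q := n / p with hq
  have hqn : p * q ≤ n := Nat.mul_div_le n p
  have hqn' : n < p * q + p := by
    have := Nat.lt_mul_div_succ n hp; rw [mul_add, mul_one] at this; exact this
  have hTq : T j ≤ q := (Nat.le_div_iff_mul_le hp).2 (by rwa [mul_comm])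
  have hqT : q ≤ T (j + 1) := by
    rw [hq]; exact Nat.div_le_of_le_mul hn'
  set d : ℕ → ℝ := fun i => e i - α with hd
  have hdD : ∀ i, d i ≤ D := fun i => by
    have := abs_le.1 (hM i); have := neg_abs_le α; simp only [hd]; linarith
  have hsum : ∑ i ∈ Finset.range n, d i ≤ 2 * D * (p * T j : ℕ) := by
    obtain ⟨r, hr⟩ := Nat.exists_eq_add_of_le hqn
    rw [hr, Finset.sum_range_add, sum_range_mul_period d p _ _ hTq]
    have h1 : ∑ i ∈ Finset.range (p * T j), d i ≤ (p * T j : ℕ) * D := by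
      simpa using Finset.sum_le_sum fun i (_ : i ∈ Finset.range (p * T j)) => hdD i
    have h2 : ∑ i ∈ Finset.range r, d (p * q + i) ≤ r * D := by
      simpa using Finset.sum_le_sum fun i (_ : i ∈ Finset.range r) => hdD (p * q + i)
    have h3 : ∑ q ∈ Finset.Ico (T j) q, ∑ i ∈ Finset.range p, d (p * q + i) ≤ 0 := by
      refine Finset.sum_nonpos fun q' hq' => ?_
      have := h j hj q' (Finset.mem_Ico.1 hq').1 ((Finset.mem_Ico.1 hq').2.trans_le hqT)
      simp only [hd, Finset.sum_sub_distrib, Finset.sum_const, Finset.card_range, nsmul_eq_mul]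
      linarith
    have h4 : (r : ℝ) ≤ (p * T j : ℕ) := by
      have : r ≤ p * T j := by lia
      exact_mod_cast this
    nlinarith
  simp only [hd, Finset.sum_sub_distrib, Finset.sum_const, Finset.card_range, nsmul_eq_mul] at hsum
  rw [runningMean, inv_mul_le_iff₀ hn0]
  have h3 : 2 * D * (p * T j : ℕ) ≤ δ * n := by
    have : 2 * D / δ * (p * T j : ℕ) ≤ n := by
      have : (0 : ℝ) ≤ (p * T j : ℕ) := by positivity
      nlinarith
    calc 2 * D * (p * T j : ℕ) = δ * (2 * D / δ * (p * T j : ℕ)) := by field_simp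
      _ ≤ δ * n := by gcongr
  linarith

theorem strictMono_two_pow_two_pow : StrictMono fun j : ℕ => 2 ^ 2 ^ j := fun a b h =>
  Nat.pow_lt_pow_right (by norm_num) (Nat.pow_lt_pow_right (by norm_num) h)

theorem eventually_mul_le_two_pow_two_pow (K : ℝ) :
    ∀ᶠ j : ℕ in atTop, K * (2 ^ 2 ^ j : ℕ) ≤ (2 ^ 2 ^ (j + 1) : ℕ) := by
  have h : Tendsto (fun j : ℕ => ((2 ^ 2 ^ j : ℕ) : ℝ)) atTop atTop :=
    tendsto_natCast_atTop_atTop.comp strictMono_two_pow_two_pow.tendsto_atTop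
  filter_upwards [h.eventually_ge_atTop K] with j hj
  rw [pow_succ 2 j, pow_mul, sq, Nat.cast_mul]
  gcongr

/-- The double logarithm of `q` recovers the window `2^(2^j) ≤ q < 2^(2^(j+1))`. The indices `q <
2`, where it takes the default value `0`, lie in no window. -/
theorem frequently_iterate_cesaro_runningMean_le {J : Set ℕ} (hJ : J.Infinite) {p : ℕ} (hp : 1 ≤ p)
    {e : ℕ → ℝ} {α M : ℝ} (hM : ∀ n, |e n| ≤ M)
    (h : ∀ q, 2 ≤ q → Nat.log 2 (Nat.log 2 q) ∈ J → ∑ i ∈ Finset.range p, e (p * q + i) ≤ p * α)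
    {α' : ℝ} (hα : α < α') (k : ℕ) : ∃ᶠ n in atTop, cesaro^[k] (runningMean e) n ≤ α' := by
  have hT : ∀ j : ℕ, 1 ≤ 2 ^ 2 ^ j := fun j => Nat.one_le_two_pow
  refine ((windowBound_runningMean (T := fun j => 2 ^ 2 ^ j) hp hT hM ?_).iterate_cesaro
    (fun j => Nat.mul_pos hp (hT j)) (abs_runningMean_le hM) k).frequently_le ?_ ?_ hJ hα
  · intro j hj q hq hq'
    have h1 : 2 ^ j ≤ Nat.log 2 q := Nat.le_log_of_pow_le (by norm_num) hq
    have h2 : Nat.log 2 q < 2 ^ (j + 1) := Nat.log_lt_of_lt_pow (Nat.ne_of_gt ((hT j).trans hq)) hq'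
    refine h q ((Nat.le_self_pow (by positivity) 2).trans hq) ?_
    rwa [(Nat.log_eq_iff (Or.inr ⟨by norm_num, Nat.ne_of_gt (Nat.one_le_two_pow.trans h1)⟩)).2 ⟨h1, h2⟩]
  · exact fun a b hab => Nat.mul_lt_mul_of_pos_left (strictMono_two_pow_two_pow hab) hp
  · intro K
    filter_upwards [eventually_mul_le_two_pow_two_pow K] with j hj
    push_cast at hj ⊢
    have : (0 : ℝ) ≤ p := by positivity
    nlinarith

theorem frequently_le_of_tendsto_sub {x y : ℕ → ℝ} (h : Tendsto (x - y) atTop (𝓝 0)) {α α' : ℝ}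
    (hα : α < α') (hy : ∃ᶠ n in atTop, y n ≤ α) : ∃ᶠ n in atTop, x n ≤ α' := by
  refine (hy.and_eventually (h.eventually_lt_const (sub_pos.2 hα))).mono fun n hn => ?_
  have := hn.2
  simp only [Pi.sub_apply] at this
  linarith [hn.1]

/-! ### A strong law for finite-range correlations. -/

section LawOfLargeNumbers

variable {Ω : Type*} [MeasurableSpace Ω] {μ : Measure Ω} [IsProbabilityMeasure μ]

/-- After expanding the square, only pairs at distance less than `r` survive, at most `2 * r` in
each row. -/
theorem integral_sq_sum_le_of_finite_range {Z : ℕ → Ω → ℝ} {M : ℝ} {r : ℕ}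
    (hZ : ∀ i, Measurable (Z i)) (hM : ∀ i ω, |Z i ω| ≤ M)
    (hr : ∀ i j, i + r ≤ j → ∫ ω, Z i ω * Z j ω ∂μ = 0) (n : ℕ) :
    ∫ ω, (∑ i ∈ Finset.range n, Z i ω) ^ 2 ∂μ ≤ n * (2 * r * M ^ 2) := by
  have hint : ∀ i j, Integrable (fun ω => Z i ω * Z j ω) μ := fun i j =>
    Integrable.of_bound ((hZ i).mul (hZ j)).aestronglyMeasurable (M * M)
      (Eventually.of_forall fun ω => by
        rw [Real.norm_eq_abs, abs_mul]
        exact mul_le_mul (hM i ω) (hM j ω) (abs_nonneg _) ((abs_nonneg _).trans (hM i ω)))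
  have hle : ∀ i j, ∫ ω, Z i ω * Z j ω ∂μ ≤ M ^ 2 := fun i j => by
    calc ∫ ω, Z i ω * Z j ω ∂μ ≤ ∫ _, M ^ 2 ∂μ :=
          integral_mono (hint i j) (integrable_const _) fun ω => by
            refine (le_abs_self _).trans ?_
            rw [abs_mul, sq]
            exact mul_le_mul (hM i ω) (hM j ω) (abs_nonneg _) ((abs_nonneg _).trans (hM i ω))
      _ = M ^ 2 := by simp
  have hrow : ∀ i, ∑ j ∈ Finset.range n, ∫ ω, Z i ω * Z j ω ∂μ ≤ 2 * r * M ^ 2 := by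
    intro i
    have hsub : (Finset.range n).filter (fun j => i < j + r ∧ j < i + r) ⊆
        Finset.Ico (i + 1 - r) (i + r) := by
      intro j hj
      simp only [Finset.mem_filter, Finset.mem_Ico] at hj ⊢
      lia
    have hcard : ((Finset.range n).filter (fun j => i < j + r ∧ j < i + r)).card ≤ 2 * r := by
      refine (Finset.card_le_card hsub).trans ?_
      rw [Nat.card_Ico]; lia
    calc ∑ j ∈ Finset.range n, ∫ ω, Z i ω * Z j ω ∂μ
        ≤ ∑ j ∈ Finset.range n, if i < j + r ∧ j < i + r then M ^ 2 else 0 := by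
          refine Finset.sum_le_sum fun j _ => ?_
          split_ifs with hc
          · exact hle i j
          · rw [not_and_or, not_lt, not_lt] at hc
            rcases hc with hc | hc
            · simp_rw [mul_comm (Z i _)]; exact (hr j i hc).le
            · exact (hr i j hc).le
      _ = ((Finset.range n).filter (fun j => i < j + r ∧ j < i + r)).card * M ^ 2 := by
          rw [← Finset.sum_filter, Finset.sum_const, nsmul_eq_mul]
      _ ≤ 2 * r * M ^ 2 := by
          gcongr
          exact_mod_cast hcard
  calc ∫ ω, (∑ i ∈ Finset.range n, Z i ω) ^ 2 ∂μ
      = ∑ i ∈ Finset.range n, ∑ j ∈ Finset.range n, ∫ ω, Z i ω * Z j ω ∂μ := by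
        simp_rw [sq, Finset.sum_mul_sum]
        rw [integral_finsetSum _ fun i _ => integrable_finsetSum _ fun j _ => hint i j]
        exact Finset.sum_congr rfl fun i _ => integral_finsetSum _ fun j _ => hint i j
    _ ≤ ∑ i ∈ Finset.range n, 2 * r * M ^ 2 := Finset.sum_le_sum fun i _ => hrow i
    _ = n * (2 * r * M ^ 2) := by simp

/-- Between `k ^ 2` and `(k + 1) ^ 2` at most `2 * k` bounded terms are added, which is negligible
against `k ^ 2`. -/
theorem tendsto_runningMean_of_tendsto_sq {e : ℕ → ℝ} {M : ℝ} (hM : ∀ n, |e n| ≤ M)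
    (h : Tendsto (fun k : ℕ => runningMean e (k ^ 2)) atTop (𝓝 0)) :
    Tendsto (runningMean e) atTop (𝓝 0) := by
  have hM0 : 0 ≤ M := (abs_nonneg _).trans (hM 0)
  have hsqrt : Tendsto Nat.sqrt atTop atTop :=
    tendsto_atTop_atTop.2 fun b => ⟨b * b, fun a ha => Nat.le_sqrt.2 ha⟩
  have hlim : Tendsto (fun n : ℕ => |runningMean e (n.sqrt ^ 2)| + 2 * M * ((n.sqrt : ℝ))⁻¹)
      atTop (𝓝 0) := by
    have h1 := (h.comp hsqrt).abs
    have h2 := ((tendsto_inv_atTop_zero.comp (tendsto_natCast_atTop_atTop (R := ℝ))).comp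
      hsqrt).const_mul (2 * M)
    simpa using h1.add h2
  refine squeeze_zero_norm' ?_ hlim
  filter_upwards [eventually_ge_atTop 1] with n hn
  set s := n.sqrt with hs
  have hs1 : 1 ≤ s := Nat.le_sqrt.2 (by simpa using hn)
  have hs1' : (1 : ℝ) ≤ s := by exact_mod_cast hs1
  have hsn : s ^ 2 ≤ n := Nat.sqrt_le' n
  have hsn' : n ≤ s ^ 2 + 2 * s := by have := Nat.sqrt_le_add n; rw [← hs] at this; nlinarith
  obtain ⟨d, hd⟩ := Nat.exists_eq_add_of_le hsn
  have hn0 : (0 : ℝ) < n := by exact_mod_cast hn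
  have hd2 : (d : ℝ) ≤ 2 * s := by
    have : d ≤ 2 * s := by lia
    exact_mod_cast this
  have hs2n : ((s : ℝ)) ^ 2 ≤ n := by exact_mod_cast hsn
  have hA : |∑ i ∈ Finset.range (s ^ 2), e i| = s ^ 2 * |runningMean e (s ^ 2)| := by
    rw [runningMean, abs_mul, ← mul_assoc, abs_of_pos (a := ((s ^ 2 : ℕ) : ℝ)⁻¹) (by positivity)]
    push_cast
    rw [mul_inv_cancel₀ (by positivity), one_mul]
  have hB : |∑ i ∈ Finset.range d, e (s ^ 2 + i)| ≤ d * M := by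
    refine (Finset.abs_sum_le_sum_abs _ _).trans ?_
    simpa using Finset.sum_le_sum fun i (_ : i ∈ Finset.range d) => hM (s ^ 2 + i)
  have hsum : |∑ i ∈ Finset.range n, e i| ≤ s ^ 2 * |runningMean e (s ^ 2)| + 2 * s * M := by
    rw [hd, Finset.sum_range_add]
    refine (abs_add_le _ _).trans ?_
    rw [hA]
    gcongr
    exact hB.trans (by gcongr)
  rw [Real.norm_eq_abs, runningMean, abs_mul, abs_of_pos (a := (n : ℝ)⁻¹) (by positivity),
    inv_mul_le_iff₀ hn0]
  refine hsum.trans ?_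
  rw [mul_add]
  refine add_le_add (by gcongr) ?_
  calc 2 * s * M = s ^ 2 * (2 * M * (s : ℝ)⁻¹) := by field_simp
    _ ≤ n * (2 * M * (s : ℝ)⁻¹) := by gcongr

/-- A strong law of large numbers for bounded sequences that are uncorrelated at distance `≥ r`. -/
theorem ae_tendsto_runningMean_of_finite_range {Z : ℕ → Ω → ℝ} {M : ℝ} {r : ℕ}
    (hZ : ∀ i, Measurable (Z i)) (hM : ∀ i ω, |Z i ω| ≤ M)
    (hr : ∀ i j, i + r ≤ j → ∫ ω, Z i ω * Z j ω ∂μ = 0) :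
    ∀ᵐ ω ∂μ, Tendsto (runningMean fun i => Z i ω) atTop (𝓝 0) := by
  set S : ℕ → Ω → ℝ := fun k ω => runningMean (fun i => Z i ω) (k ^ 2) with hS
  have hSm : ∀ k, Measurable (S k) := fun k =>
    (Finset.measurable_fun_sum _ fun i _ => hZ i).const_mul _
  have hSM : ∀ k ω, |S k ω| ≤ M := fun k ω => abs_runningMean_le (fun i => hM i ω) _
  have hint : ∀ k, Integrable (fun ω => S k ω ^ 2) μ := fun k =>
    Integrable.of_bound ((hSm k).pow_const 2).aestronglyMeasurable (M ^ 2)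
      (Eventually.of_forall fun ω => by
        rw [Real.norm_eq_abs, abs_pow]
        exact pow_le_pow_left₀ (abs_nonneg _) (hSM k ω) 2)
  have hle : ∀ k : ℕ, ∫ ω, S k ω ^ 2 ∂μ ≤ 2 * r * M ^ 2 * (1 / (k : ℝ) ^ 2) := by
    intro k
    have h := integral_sq_sum_le_of_finite_range hZ hM hr (k ^ 2)
    simp_rw [hS, runningMean, mul_pow]
    rw [integral_const_mul]
    rcases Nat.eq_zero_or_pos k with rfl | hk
    · simp
    have hk' : (0 : ℝ) < k := by exact_mod_cast hk
    calc ((k ^ 2 : ℕ) : ℝ)⁻¹ ^ 2 * ∫ ω, (∑ i ∈ Finset.range (k ^ 2), Z i ω) ^ 2 ∂μ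
        ≤ ((k ^ 2 : ℕ) : ℝ)⁻¹ ^ 2 * ((k ^ 2 : ℕ) * (2 * r * M ^ 2)) := by gcongr
      _ = 2 * r * M ^ 2 * (1 / (k : ℝ) ^ 2) := by push_cast; field_simp
  -- Along squares the second moments are summable, so almost surely the series of squares converges
  -- and its terms tend to zero.
  have hlin : ∫⁻ ω, ∑' k, ENNReal.ofReal (S k ω ^ 2) ∂μ ≠ ∞ := by
    rw [lintegral_tsum fun k => ((hSm k).pow_const 2).ennreal_ofReal.aemeasurable]
    have hsummable : Summable fun k : ℕ => 2 * r * M ^ 2 * (1 / (k : ℝ) ^ 2) :=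
      (Real.summable_one_div_nat_pow.2 (by norm_num)).mul_left _
    refine ne_top_of_le_ne_top hsummable.tsum_ofReal_ne_top (ENNReal.tsum_le_tsum fun k => ?_)
    rw [← ofReal_integral_eq_lintegral_ofReal (hint k)
      (Eventually.of_forall fun ω => sq_nonneg _)]
    exact ENNReal.ofReal_le_ofReal (hle k)
  have hae := ae_lt_top (μ := μ)
    (Measurable.tsum fun k => ((hSm k).pow_const 2).ennreal_ofReal) hlin
  filter_upwards [hae] with ω hω
  refine tendsto_runningMean_of_tendsto_sq (fun i => hM i ω) ?_
  have h0 := ENNReal.tendsto_atTop_zero_of_tsum_ne_top hω.ne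
  have h1 : Tendsto (fun k => S k ω ^ 2) atTop (𝓝 0) := by
    have := (ENNReal.tendsto_toReal ENNReal.zero_ne_top).comp h0
    simpa [Function.comp_def, ENNReal.toReal_ofReal, sq_nonneg] using this
  have h2 := h1.sqrt
  simp only [Real.sqrt_sq_eq_abs, Real.sqrt_zero] at h2
  exact (tendsto_zero_iff_abs_tendsto_zero _).2 h2

end LawOfLargeNumbers

theorem birkhoffAverage_eq_runningMean {X : Type*} (T : X → X) (f : X → ℝ) (n : ℕ) (x : X) :
    birkhoffAverage ℝ T f n x = runningMean (fun i => f (T^[i] x)) n := by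
  simp [birkhoffAverage, birkhoffSum, runningMean]

theorem leftShift_iterate_apply {A : Type*} (i : ℕ) (x : ℕ → A) (n : ℕ) :
    leftShift^[i] x n = x (n + i) := by
  induction i generalizing x with
  | zero => rfl
  | succ i ih => rw [Function.iterate_succ_apply, ih, leftShift, add_assoc]

/-! ### Topology of the full shift and its Bernoulli measure. -/

section FullShift

variable {m : ℕ}

theorem continuous_leftShift : Continuous (leftShift (A := Fin m)) :=
  continuous_pi fun n => continuous_apply (n + 1)

/-- A Lebesgue number for the cover, by compactness; it also yields uniform continuity below. -/
theorem exists_forall_cylinder_subset {𝒜 : Set (Set (ℕ → Fin m))} (hopen : ∀ U ∈ 𝒜, IsOpen U)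
    (hcov : ⋃₀ 𝒜 = univ) : ∃ N : ℕ, ∀ x, ∃ U ∈ 𝒜, PiNat.cylinder x N ⊆ U := by
  have hx : ∀ x : ℕ → Fin m, ∃ n : ℕ, ∃ U ∈ 𝒜, PiNat.cylinder x n ⊆ U := by
    intro x
    obtain ⟨U, hU, hxU⟩ := mem_sUnion.1 (hcov ▸ mem_univ x)
    obtain ⟨_, ⟨y, n, rfl⟩, hxy, hsub⟩ :=
      (PiNat.isTopologicalBasis_cylinders (fun _ : ℕ => Fin m)).exists_subset_of_mem_open hxU
        (hopen U hU)
    exact ⟨n, U, hU, by rwa [PiNat.mem_cylinder_iff_eq.1 hxy]⟩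
  choose n U hU hsub using hx
  obtain ⟨t, -, ht⟩ := isCompact_univ.elim_nhds_subcover (fun x => PiNat.cylinder x (n x))
    fun x _ => (PiNat.isOpen_cylinder _ x (n x)).mem_nhds (PiNat.self_mem_cylinder _ _)
  refine ⟨t.sup n, fun x => ?_⟩
  obtain ⟨y, hy, hxy⟩ := mem_iUnion₂.1 (ht (mem_univ x))
  refine ⟨U y, hU y, Subset.trans ?_ (hsub y)⟩
  rw [← PiNat.mem_cylinder_iff_eq.1 hxy]
  exact PiNat.cylinder_anti _ (Finset.le_sup hy)

theorem Continuous.exists_forall_agree_abs_sub_lt {f : (ℕ → Fin m) → ℝ} (hf : Continuous f) {ε : ℝ}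
    (hε : 0 < ε) : ∃ r : ℕ, ∀ x y, (∀ i < r, x i = y i) → |f x - f y| < ε := by
  obtain ⟨r, hr⟩ := exists_forall_cylinder_subset
    (𝒜 := range fun c : ℝ => f ⁻¹' Metric.ball c (ε / 2))
    (by rintro _ ⟨c, rfl⟩; exact Metric.isOpen_ball.preimage hf)
    (eq_univ_of_forall fun x => ⟨_, ⟨f x, rfl⟩, by simpa using hε⟩)
  refine ⟨r, fun x y hxy => ?_⟩
  obtain ⟨_, ⟨c, rfl⟩, hc⟩ := hr y
  have h1 := hc (PiNat.mem_cylinder_iff.2 hxy)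
  have h2 := hc (PiNat.self_mem_cylinder y r)
  simp only [mem_preimage, Metric.mem_ball, Real.dist_eq] at h1 h2
  rw [abs_lt] at *
  constructor <;> linarith

theorem Continuous.exists_abs_le {f : (ℕ → Fin m) → ℝ} (hf : Continuous f) :
    ∃ M : ℝ, ∀ x, |f x| ≤ M := by
  obtain ⟨M, hM⟩ := (isCompact_range hf).isBounded.exists_norm_le
  exact ⟨M, fun x => hM _ ⟨x, rfl⟩⟩

variable [NeZero m]

/-- The uniform Bernoulli measure on the full shift on `m` symbols. -/
noncomputable def shiftMeasure (m : ℕ) [NeZero m] : Measure (ℕ → Fin m) :=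
  Measure.infinitePi fun _ => uniformOn univ

instance : IsProbabilityMeasure (shiftMeasure m) := by
  unfold shiftMeasure; infer_instance

theorem measurePreserving_leftShift_iterate (i : ℕ) :
    MeasurePreserving leftShift^[i] (shiftMeasure m) (shiftMeasure m) := by
  have h : leftShift^[i] = fun (x : ℕ → Fin m) n => x (n + i) := by
    funext x n; exact leftShift_iterate_apply i x n
  rw [h]
  exact ⟨by fun_prop, Measure.map_infinitePi_infinitePi_of_inj (add_left_injective i)⟩

theorem integral_mul_of_dependsOn {g h : (ℕ → Fin m) → ℝ} {S T : Finset ℕ} (hST : Disjoint S T)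
    (hg : DependsOn g (S : Set ℕ)) (hh : DependsOn h (T : Set ℕ)) :
    ∫ x, g x * h x ∂shiftMeasure m =
      (∫ x, g x ∂shiftMeasure m) * ∫ x, h x ∂shiftMeasure m := by
  obtain ⟨g', rfl⟩ := dependsOn_iff_exists_comp.1 hg
  obtain ⟨h', rfl⟩ := dependsOn_iff_exists_comp.1 hh
  have hind : iIndepFun (fun (i : ℕ) (x : ℕ → Fin m) => x i) (shiftMeasure m) :=
    iIndepFun_infinitePi (P := fun _ => uniformOn univ) (X := fun _ a => a) fun _ => measurable_id
  refine (hind.indepFun_finset S T hST fun i => measurable_pi_apply i).integral_fun_comp_mul_comp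
    (f := g') (g := h') ?_ ?_ ?_ ?_
  · exact (measurable_pi_lambda _ fun i => measurable_pi_apply _).aemeasurable
  · exact (measurable_pi_lambda _ fun i => measurable_pi_apply _).aemeasurable
  · exact Measurable.aestronglyMeasurable (measurable_of_finite _)
  · exact Measurable.aestronglyMeasurable (measurable_of_finite _)

theorem shiftMeasure_pi_singleton (s : Finset ℕ) (y : ℕ → Fin m) :
    shiftMeasure m (Set.pi s fun i => {y i}) = (m : ℝ≥0∞)⁻¹ ^ s.card := by
  rw [shiftMeasure, Measure.infinitePi_pi _ fun i _ => MeasurableSet.singleton _]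
  simp [uniformOn_univ]

end FullShift

/-! ### Random sequences with overwritten coordinates. -/

open Classical in
/-- The sequence obtained from `x` by overwriting the coordinates in `F` by those of `w`. -/
noncomputable def overwrite {A : Type*} (F : Set ℕ) (w x : ℕ → A) : ℕ → A :=
  fun i => if i ∈ F then w i else x i

theorem overwrite_of_mem {A : Type*} {F : Set ℕ} {w x : ℕ → A} {i : ℕ} (h : i ∈ F) :
    overwrite F w x i = w i := if_pos h

theorem overwrite_of_notMem {A : Type*} {F : Set ℕ} {w x : ℕ → A} {i : ℕ} (h : i ∉ F) :
    overwrite F w x i = x i := if_neg h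

section Overwrite

variable {m : ℕ}

theorem continuous_overwrite (F : Set ℕ) (w : ℕ → Fin m) : Continuous (overwrite F w) := by
  refine continuous_pi fun i => ?_
  by_cases h : i ∈ F
  · simp_rw [overwrite_of_mem h]; exact continuous_const
  · simp_rw [overwrite_of_notMem h]; exact continuous_apply i

theorem continuous_comp_overwrite {f : (ℕ → Fin m) → ℝ} (hf : Continuous f) (F : Set ℕ)
    (w : ℕ → Fin m) (i : ℕ) : Continuous fun x => f (leftShift^[i] (overwrite F w x)) :=
  hf.comp ((continuous_leftShift.iterate i).comp (continuous_overwrite F w))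

variable [NeZero m]

/-- Truncation of a sequence to its first `r` symbols. -/
def truncate (r : ℕ) (x : ℕ → Fin m) : ℕ → Fin m := fun i => if i < r then x i else 0

theorem continuous_truncate (r : ℕ) : Continuous (truncate (m := m) r) := by
  refine continuous_pi fun i => ?_
  by_cases h : i < r
  · simp only [truncate, h, if_true]; exact continuous_apply i
  · simp only [truncate, h, if_false]; exact continuous_const

theorem integrable_of_continuous {f : (ℕ → Fin m) → ℝ} (hf : Continuous f) :
    Integrable f (shiftMeasure m) := by
  obtain ⟨M, hM⟩ := hf.exists_abs_le
  exact Integrable.of_bound hf.measurable.aestronglyMeasurable M (Eventually.of_forall hM)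

theorem abs_integral_le {g : (ℕ → Fin m) → ℝ} {M : ℝ} (h : ∀ x, |g x| ≤ M) :
    |∫ x, g x ∂shiftMeasure m| ≤ M := by
  simpa using norm_integral_le_of_norm_le_const (μ := shiftMeasure m) 
    (f := g) (C := M) (Eventually.of_forall h)

/-- Birkhoff averages along a randomly overwritten sequence follow their expectations. -/
theorem ae_tendsto_birkhoffAverage_overwrite {f : (ℕ → Fin m) → ℝ} (hf : Continuous f) (F : Set ℕ)
    (w : ℕ → Fin m) : ∀ᵐ x ∂shiftMeasure m,
      Tendsto ((fun n => birkhoffAverage ℝ leftShift f n (overwrite F w x)) -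
        runningMean fun i => ∫ x, f (leftShift^[i] (overwrite F w x)) ∂shiftMeasure m)
        atTop (𝓝 0) := by
  obtain ⟨M, hM⟩ := hf.exists_abs_le
  set e : ℕ → ℝ := fun i => ∫ x, f (leftShift^[i] (overwrite F w x)) ∂shiftMeasure m with he
  have key : ∀ k : ℕ, ∀ᵐ x ∂shiftMeasure m, ∀ᶠ n in atTop,
      |birkhoffAverage ℝ leftShift f n (overwrite F w x) - runningMean e n| <
        3 * (1 / ((k : ℝ) + 1)) := by
    intro k
    have hδ : 0 < 1 / ((k : ℝ) + 1) := by positivity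
    set δ := 1 / ((k : ℝ) + 1)
    obtain ⟨r, hr⟩ := hf.exists_forall_agree_abs_sub_lt hδ
    -- Truncation makes the `i`-th observable depend only on coordinates in `[i, i + r)`, so
    -- observables at distance at least `r` are independent. They need not be identically
    -- distributed, hence the centring by `c i`.
    set g : ℕ → (ℕ → Fin m) → ℝ := fun i x => f (truncate r (leftShift^[i] (overwrite F w x)))
    have hgc : ∀ i, Continuous (g i) := fun i =>
      continuous_comp_overwrite (hf.comp (continuous_truncate r)) F w i
    have hgdep : ∀ i, DependsOn (g i) (Finset.Ico i (i + r) : Set ℕ) := by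
      intro i x y hxy
      refine congrArg f (funext fun j => ?_)
      by_cases hj : j < r
      · simp only [truncate, hj, if_true, leftShift_iterate_apply]
        by_cases hF : j + i ∈ F
        · rw [overwrite_of_mem hF, overwrite_of_mem hF]
        · rw [overwrite_of_notMem hF, overwrite_of_notMem hF]
          exact hxy _ (by simp only [Finset.coe_Ico, mem_Ico]; lia)
      · simp [truncate, hj]
    have hfg : ∀ i x, |f (leftShift^[i] (overwrite F w x)) - g i x| ≤ δ := fun i x =>
      (hr _ _ fun j hj => by simp [truncate, hj]).le
    set c : ℕ → ℝ := fun i => ∫ x, g i x ∂shiftMeasure m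
    have hec : ∀ i, |e i - c i| ≤ δ := fun i => by
      rw [he, ← integral_sub (integrable_of_continuous (continuous_comp_overwrite hf F w i))
        (integrable_of_continuous (hgc i))]
      exact abs_integral_le (hfg i)
    have hgM : ∀ i x, |g i x| ≤ M := fun i x => hM _
    have hlln := ae_tendsto_runningMean_of_finite_range (μ := shiftMeasure m)
      (Z := fun i x => g i x - c i) (M := 2 * M) (r := r)
      (fun i => ((hgc i).sub continuous_const).measurable)
      (fun i x => by
        have := abs_sub (g i x) (c i)
        linarith [hgM i x, abs_integral_le (hgM i)])
      (fun i j hij => by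
        have hdep : ∀ i, DependsOn (fun x => g i x - c i) (Finset.Ico i (i + r) : Set ℕ) :=
          fun i x y hxy => by simp only [hgdep i hxy]
        rw [integral_mul_of_dependsOn (S := Finset.Ico i (i + r)) (T := Finset.Ico j (j + r))
          ?_ (hdep i) (hdep j), integral_sub (integrable_of_continuous (hgc i))
          (integrable_const _)]
        · simp [c]
        · exact Finset.Ico_disjoint_Ico_consecutive _ _ _ |>.mono_right
            (Finset.Ico_subset_Ico_left hij))
    filter_upwards [hlln] with x hx
    filter_upwards [Metric.tendsto_nhds.1 hx δ hδ] with n hn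
    have hdiff := abs_runningMean_le (e := fun i =>
      (f (leftShift^[i] (overwrite F w x)) - g i x) - (e i - c i)) (M := 2 * δ)
      (fun i => by
        have := abs_sub (f (leftShift^[i] (overwrite F w x)) - g i x) (e i - c i)
        linarith [hfg i x, hec i]) n
    have heq : birkhoffAverage ℝ leftShift f n (overwrite F w x) - runningMean e n =
        runningMean (fun i => (f (leftShift^[i] (overwrite F w x)) - g i x) - (e i - c i)) n +
          runningMean (fun i => g i x - c i) n := by
      rw [birkhoffAverage_eq_runningMean]
      simp only [runningMean, Finset.sum_sub_distrib]
      ring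
    rw [Real.dist_eq, sub_zero] at hn
    rw [heq]
    refine (abs_add_le _ _).trans_lt ?_
    linarith
  filter_upwards [ae_all_iff.2 key] with x hx
  refine Metric.tendsto_nhds.2 fun ε hε => ?_
  obtain ⟨k, hk⟩ := exists_nat_one_div_lt (show 0 < ε / 3 by positivity)
  filter_upwards [hx k] with n hn
  rw [Real.dist_eq, sub_zero, Pi.sub_apply]
  linarith

end Overwrite

/-! ### Bowen entropy: upper bound and mass distribution. -/

section CoverTime

variable {X : Type*} {T : X → X} {𝒜 : Set (Set X)} {E : Set X}

theorem le_coverTime {n : ℕ} (h : ∀ k < n, ∃ U ∈ 𝒜, T^[k] '' E ⊆ U) :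
    (n : ℕ∞) ≤ coverTime T 𝒜 E :=
  le_sSup fun k hk => h k (by exact_mod_cast hk)

theorem exists_image_subset_of_lt_coverTime {k : ℕ} (h : (k : ℕ∞) < coverTime T 𝒜 E) :
    ∃ U ∈ 𝒜, T^[k] '' E ⊆ U := by
  obtain ⟨n, hn, hkn⟩ := lt_sSup_iff.1 h
  exact hn k hkn

theorem coverSize_eq_of_coverTime_eq {n : ℕ} (h : coverTime T 𝒜 E = n) :
    coverSize T 𝒜 E = ENNReal.ofReal (Real.exp (-n)) := by
  have h' : (((n : ℕ∞) : ℝ≥0∞) : EReal) = ((n : ℝ) : EReal) := by simp; rfl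
  rw [coverSize, h, h', ← EReal.coe_neg, EReal.exp_coe]

theorem coverSize_le_of_le_coverTime {n : ℕ} (h : (n : ℕ∞) ≤ coverTime T 𝒜 E) :
    coverSize T 𝒜 E ≤ ENNReal.ofReal (Real.exp (-n)) := by
  have h' : (((n : ℕ∞) : ℝ≥0∞) : EReal) = ((n : ℝ) : EReal) := by simp; rfl
  rw [coverSize, ← EReal.exp_coe, EReal.coe_neg, ← h']
  refine EReal.exp_monotone (EReal.neg_le_neg_iff.2 ?_)
  exact_mod_cast h

theorem ofReal_exp_neg_rpow (n : ℕ) {s : ℝ} :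
    ENNReal.ofReal (Real.exp (-n)) ^ s = ENNReal.ofReal (Real.exp (-(s * n))) := by
  rw [ENNReal.ofReal_rpow_of_pos (Real.exp_pos _), ← Real.exp_mul]
  ring_nf

end CoverTime

section FullShift

variable {m : ℕ}

/-- Cover by all cylinders of length `n + N`, with `N` a Lebesgue number: at most `m ^ (n + N)`
sets, each of size at most `exp (-n)`. -/
theorem bowenMeasure_eq_zero_of_log_lt [NeZero m] {𝒜 : Set (Set (ℕ → Fin m))}
    (h𝒜 : IsFiniteOpenCover 𝒜) {s : ℝ} (hs : Real.log m < s) (Y : Set (ℕ → Fin m)) :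
    bowenMeasure leftShift 𝒜 s Y = 0 := by
  obtain ⟨N, hN⟩ := exists_forall_cylinder_subset h𝒜.2.1 h𝒜.2.2
  have hm : (0 : ℝ) < m := by exact_mod_cast Nat.pos_of_ne_zero (NeZero.ne m)
  have hs0 : 0 < s := (Real.log_natCast_nonneg m).trans_lt hs
  have hsize : ∀ (n : ℕ) (y : ℕ → Fin m),
      coverSize leftShift 𝒜 (PiNat.cylinder y (n + N)) ≤ ENNReal.ofReal (Real.exp (-n)) := by
    intro n y
    refine coverSize_le_of_le_coverTime (le_coverTime fun k hk => ?_)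
    obtain ⟨U, hU, hsub⟩ := hN (leftShift^[k] y)
    refine ⟨U, hU, Subset.trans ?_ hsub⟩
    rintro _ ⟨z, hz, rfl⟩
    refine PiNat.mem_cylinder_iff.2 fun i hi => ?_
    rw [leftShift_iterate_apply, leftShift_iterate_apply]
    exact PiNat.mem_cylinder_iff.1 hz _ (by lia)
  set ext : (n : ℕ) → (Fin n → Fin m) → (ℕ → Fin m) :=
    fun n v i => if h : i < n then v ⟨i, h⟩ else 0 with hext
  set 𝒞 : ℕ → Finset (Set (ℕ → Fin m)) := fun n => by
    classical exact Finset.univ.image fun v => PiNat.cylinder (ext (n + N) v) (n + N) with h𝒞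
  have hmem : ∀ n, ∀ E ∈ 𝒞 n, ∃ y, E = PiNat.cylinder y (n + N) := by
    intro n E hE
    obtain ⟨v, -, rfl⟩ := Finset.mem_image.1 hE
    exact ⟨_, rfl⟩
  have hcard : ∀ n, (𝒞 n).card ≤ m ^ (n + N) := fun n =>
    Finset.card_image_le.trans (by simp)
  have hcover : ∀ n, Y ⊆ ⋃₀ (𝒞 n : Set (Set (ℕ → Fin m))) := by
    intro n y _
    refine ⟨_, Finset.mem_coe.2 (Finset.mem_image.2 ⟨fun i => y i, Finset.mem_univ _, rfl⟩), ?_⟩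
    refine PiNat.mem_cylinder_iff.2 fun i hi => ?_
    simp [hext, hi]
  have hsum : ∀ n : ℕ, ∑' E : (𝒞 n : Set (Set (ℕ → Fin m))),
      coverSize leftShift 𝒜 (E : Set (ℕ → Fin m)) ^ s ≤
        ENNReal.ofReal (m ^ N * Real.exp (-(s - Real.log m)) ^ n) := by
    intro n
    have h1 : ∑' E : (𝒞 n : Set (Set (ℕ → Fin m))),
        coverSize leftShift 𝒜 (E : Set (ℕ → Fin m)) ^ s =
          ∑ E ∈ 𝒞 n, coverSize leftShift 𝒜 E ^ s :=
      Finset.tsum_subtype (𝒞 n) fun E => coverSize leftShift 𝒜 E ^ s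
    rw [h1]
    calc ∑ E ∈ 𝒞 n, coverSize leftShift 𝒜 E ^ s
        ≤ ∑ E ∈ 𝒞 n, ENNReal.ofReal (Real.exp (-(s * n))) := by
          refine Finset.sum_le_sum fun E hE => ?_
          obtain ⟨y, rfl⟩ := hmem n E hE
          rw [← ofReal_exp_neg_rpow]
          exact ENNReal.rpow_le_rpow (hsize n y) hs0.le
      _ = (𝒞 n).card * ENNReal.ofReal (Real.exp (-(s * n))) := by simp
      _ ≤ (m ^ (n + N) : ℕ) * ENNReal.ofReal (Real.exp (-(s * n))) := by
          gcongr
          exact hcard n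
      _ = ENNReal.ofReal (m ^ N * Real.exp (-(s - Real.log m)) ^ n) := by
          rw [← ENNReal.ofReal_natCast, ← ENNReal.ofReal_mul (by positivity)]
          congr 1
          rw [← Real.exp_nat_mul, show (n : ℝ) * -(s - Real.log m) = Real.log m * n + -(s * n) by
            ring, Real.exp_add, Real.exp_mul, Real.exp_log hm, Real.rpow_natCast]
          push_cast
          ring
  have hlim : Tendsto (fun n : ℕ => ENNReal.ofReal (m ^ N * Real.exp (-(s - Real.log m)) ^ n))
      atTop (𝓝 0) := by
    have := (tendsto_pow_atTop_nhds_zero_of_lt_one (Real.exp_pos (-(s - Real.log m))).le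
      (Real.exp_zero ▸ Real.exp_lt_exp.2 (by linarith))).const_mul ((m : ℝ) ^ N)
    simpa using ENNReal.tendsto_ofReal this
  have hsmall : Tendsto (fun n : ℕ => ENNReal.ofReal (Real.exp (-n))) atTop (𝓝 0) := by
    have := Real.tendsto_exp_neg_atTop_nhds_zero.comp (tendsto_natCast_atTop_atTop (R := ℝ))
    simpa [Function.comp_def] using ENNReal.tendsto_ofReal this
  refine le_antisymm (iSup₂_le fun ε hε => ge_of_tendsto hlim ?_) zero_le
  filter_upwards [hsmall.eventually_lt_const hε] with n hn
  refine (iInf₂_le_of_le (𝒞 n : Set (Set (ℕ → Fin m))) (𝒞 n).countable_toSet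
    (iInf₂_le_of_le (hcover n) (fun E hE => ?_) (hsum n)))
  obtain ⟨y, rfl⟩ := hmem n E hE
  exact (hsize n y).trans_lt hn

theorem bowenEntropy_le_log [NeZero m] (Y : Set (ℕ → Fin m)) :
    bowenEntropy (leftShift (A := Fin m)) Y ≤ ((Real.log (m : ℝ) : ℝ) : EReal) := by
  refine iSup₂_le fun 𝒜 h𝒜 => EReal.le_of_forall_lt_iff_le.1 fun s hs => ?_
  have hs' : Real.log m < s := by exact_mod_cast hs
  exact iInf₂_le_of_le s ((Real.log_natCast_nonneg m).trans_lt hs')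
    (iInf_le_of_le (bowenMeasure_eq_zero_of_log_lt h𝒜 hs' Y) le_rfl)

/-- The partition of the full shift into cylinders of length one. -/
def symbolPartition (m : ℕ) : Set (Set (ℕ → Fin m)) := range fun a => {x | x 0 = a}

theorem isFiniteOpenCover_symbolPartition : IsFiniteOpenCover (symbolPartition m) := by
  refine ⟨finite_range _, ?_, eq_univ_of_forall fun x => ⟨_, ⟨x 0, rfl⟩, rfl⟩⟩
  rintro _ ⟨a, rfl⟩
  exact (isOpen_discrete ({a} : Set (Fin m))).preimage
    (continuous_apply (A := fun _ : ℕ => Fin m) 0)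

theorem subset_cylinder_of_le_coverTime {E : Set (ℕ → Fin m)} {y : ℕ → Fin m} (hy : y ∈ E) {n : ℕ}
    (hn : (n : ℕ∞) ≤ coverTime leftShift (symbolPartition m) E) : E ⊆ PiNat.cylinder y n := by
  intro z hz
  refine PiNat.mem_cylinder_iff.2 fun i hi => ?_
  obtain ⟨_, ⟨a, rfl⟩, hsub⟩ := exists_image_subset_of_lt_coverTime
    (lt_of_lt_of_le (by exact_mod_cast hi : (i : ℕ∞) < n) hn)
  have h1 := hsub ⟨z, hz, rfl⟩
  have h2 := hsub ⟨y, hy, rfl⟩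
  simp only [mem_ofPred_eq, leftShift_iterate_apply, zero_add] at h1 h2
  rw [h1, h2]

/-- The mass distribution principle for Bowen's outer measures on the full shift. -/
theorem bowenMeasure_ne_zero_of_cylinder_le {Ω : Type*} [MeasurableSpace Ω] {μ : Measure Ω}
    {Φ : Ω → ℕ → Fin m} {C : ℝ≥0∞} (hC : C ≠ ∞) {s : ℝ} (hs : 0 < s)
    (hcyl : ∀ y n, μ (Φ ⁻¹' PiNat.cylinder y n) ≤ C * ENNReal.ofReal (Real.exp (-(s * n))))
    {Y : Set (ℕ → Fin m)} (hY : μ (Φ ⁻¹' Y) ≠ 0) :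
    bowenMeasure leftShift (symbolPartition m) s Y ≠ 0 := by
  have key : ∀ E, μ (Φ ⁻¹' E) ≤ C * coverSize leftShift (symbolPartition m) E ^ s := by
    intro E
    rcases E.eq_empty_or_nonempty with rfl | ⟨y, hy⟩
    · simp
    have hle : ∀ n : ℕ, (n : ℕ∞) ≤ coverTime leftShift (symbolPartition m) E →
        μ (Φ ⁻¹' E) ≤ C * ENNReal.ofReal (Real.exp (-(s * n))) := fun n hn =>
      (measure_mono (preimage_mono (subset_cylinder_of_le_coverTime hy hn))).trans (hcyl y n)
    cases hN : coverTime leftShift (symbolPartition m) E with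
    | coe N =>
      rw [coverSize_eq_of_coverTime_eq hN, ofReal_exp_neg_rpow]
      exact hle N hN.ge
    -- Such a set has size `0`; it lies in cylinders of every length, so its mass vanishes too.
    | top =>
      have hlim : Tendsto (fun n : ℕ => C * ENNReal.ofReal (Real.exp (-(s * n)))) atTop
          (𝓝 (C * 0)) := by
        refine ENNReal.Tendsto.const_mul ?_ (Or.inr hC)
        have := Real.tendsto_exp_neg_atTop_nhds_zero.comp
          ((tendsto_natCast_atTop_atTop (R := ℝ)).const_mul_atTop hs)
        simpa [Function.comp_def] using ENNReal.tendsto_ofReal this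
      rw [mul_zero] at hlim
      exact (ge_of_tendsto' hlim fun n => hle n (by rw [hN]; exact le_top)).trans zero_le
  have hpos : 0 < μ (Φ ⁻¹' Y) / C := ENNReal.div_pos hY hC
  -- The estimate holds for covers of any mesh, so `ε = 1` suffices.
  refine (hpos.trans_le (le_iSup₂_of_le (1 : ℝ≥0∞) one_pos ?_)).ne'
  refine le_iInf₂ fun 𝒞 h𝒞 => le_iInf₂ fun hcov _ => ENNReal.div_le_of_le_mul' ?_
  have := h𝒞.to_subtype
  calc μ (Φ ⁻¹' Y) ≤ μ (⋃ E : 𝒞, Φ ⁻¹' (E : Set (ℕ → Fin m))) := by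
        refine measure_mono fun ω hω => ?_
        obtain ⟨E, hE, hmem⟩ := hcov hω
        exact mem_iUnion.2 ⟨⟨E, hE⟩, hmem⟩
    _ ≤ ∑' E : 𝒞, μ (Φ ⁻¹' (E : Set (ℕ → Fin m))) := measure_iUnion_le _
    _ ≤ ∑' E : 𝒞, C * coverSize leftShift (symbolPartition m) (E : Set (ℕ → Fin m)) ^ s :=
        ENNReal.tsum_le_tsum fun E => key E
    _ = C * ∑' E : 𝒞, coverSize leftShift (symbolPartition m) (E : Set (ℕ → Fin m)) ^ s :=
        ENNReal.tsum_mul_left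

theorem log_le_bowenEntropy {Y : Set (ℕ → Fin m)}
    (h : ∀ s, 0 < s → s < Real.log m → bowenMeasure leftShift (symbolPartition m) s Y ≠ 0) :
    ((Real.log (m : ℝ) : ℝ) : EReal) ≤ bowenEntropy (leftShift (A := Fin m)) Y := by
  refine le_iSup₂_of_le (symbolPartition m) isFiniteOpenCover_symbolPartition ?_
  refine le_iInf₂ fun s hs => le_iInf fun hzero => ?_
  by_contra hlt
  exact h s hs (by exact_mod_cast not_le.1 hlt) hzero

theorem card_filter_mod_lt_le (l p n : ℕ) :
    ((Finset.range n).filter fun i => i % p < l).card ≤ l * (n / p + 1) := by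
  calc ((Finset.range n).filter fun i => i % p < l).card
      ≤ (Finset.range l ×ˢ Finset.range (n / p + 1)).card := by
        refine Finset.card_le_card_of_injOn (fun i => (i % p, i / p)) ?_ ?_
        · intro i hi
          simp only [Finset.coe_filter, Finset.mem_range, mem_ofPred_eq] at hi
          simp only [Finset.coe_product, Finset.coe_range, mem_prod, mem_Iio]
          exact ⟨hi.2, Nat.lt_succ_of_le (Nat.div_le_div_right hi.1.le)⟩
        · intro i _ j _ hij
          simp only [Prod.mk.injEq] at hij
          rw [← Nat.mod_add_div i p, hij.1, hij.2, Nat.mod_add_div]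
    _ = l * (n / p + 1) := by simp

/-- Only the coordinates outside `F` are random, and at least `n - l * (n / p + 1)` of the first `n`
are; the `+ 1` for the partial period costs the factor `m ^ l`. -/
theorem shiftMeasure_preimage_cylinder_le [NeZero m] {F : Set ℕ} {l p : ℕ}
    (hF : ∀ i ∈ F, i % p < l) {s : ℝ} (hs : s ≤ (1 - l / p) * Real.log m) (w y : ℕ → Fin m)
    (n : ℕ) : shiftMeasure m (overwrite F w ⁻¹' PiNat.cylinder y n) ≤
      ENNReal.ofReal (m ^ l) * ENNReal.ofReal (Real.exp (-(s * n))) := by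
  classical
  have hm : (0 : ℝ) < m := by exact_mod_cast Nat.pos_of_ne_zero (NeZero.ne m)
  have hm1 : (1 : ℝ) ≤ m := by exact_mod_cast Nat.pos_of_ne_zero (NeZero.ne m)
  set S := (Finset.range n).filter (· ∉ F)
  have hcard : (n : ℝ) ≤ S.card + l * (n / p + 1) := by
    have h1 : ((Finset.range n).filter (· ∈ F)).card ≤ l * (n / p + 1) :=
      (Finset.card_le_card (Finset.monotone_filter_right _ fun i _ hi => hF i hi)).trans
        (card_filter_mod_lt_le l p n)
    have h2 := Finset.card_filter_add_card_filter_not (s := Finset.range n) (· ∈ F)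
    rw [Finset.card_range] at h2
    have h3 : (n : ℝ) ≤ S.card + l * ((n / p : ℕ) + 1) := by
      have : n ≤ S.card + l * (n / p + 1) := by simp only [S]; lia
      exact_mod_cast this
    have h4 : ((n / p : ℕ) : ℝ) ≤ n / p := Nat.cast_div_le
    nlinarith [Nat.cast_nonneg (α := ℝ) l]
  calc shiftMeasure m (overwrite F w ⁻¹' PiNat.cylinder y n)
      ≤ shiftMeasure m (Set.pi S fun i => {y i}) := by
        refine measure_mono fun x hx i hi => ?_
        have hi' := Finset.mem_filter.1 hi
        have := PiNat.mem_cylinder_iff.1 hx i (Finset.mem_range.1 hi'.1)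
        rwa [overwrite_of_notMem hi'.2] at this
    _ = ENNReal.ofReal (Real.exp (-(S.card * Real.log m))) := by
        rw [shiftMeasure_pi_singleton, ← ENNReal.ofReal_natCast, ← ENNReal.ofReal_inv_of_pos hm,
          ← ENNReal.ofReal_pow (by positivity), Real.exp_neg, Real.exp_nat_mul, Real.exp_log hm,
          inv_pow]
    _ ≤ ENNReal.ofReal (Real.exp (l * Real.log m + -(s * n))) := by
        refine ENNReal.ofReal_le_ofReal (Real.exp_le_exp.2 ?_)
        have hlog : 0 ≤ Real.log m := Real.log_nonneg hm1
        have h5 : s * n ≤ (1 - l / p) * Real.log m * n := by gcongr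
        have h6 : (n - (l : ℝ) * (n / p + 1)) * Real.log m ≤ S.card * Real.log m := by
          gcongr; linarith
        have h7 : (n - (l : ℝ) * (n / p + 1)) * Real.log m =
            (1 - l / p) * Real.log m * n - l * Real.log m := by ring
        linarith
    _ = ENNReal.ofReal (m ^ l) * ENNReal.ofReal (Real.exp (-(s * n))) := by
        rw [Real.exp_add, Real.exp_nat_mul, Real.exp_log hm, ENNReal.ofReal_mul (by positivity)]

end FullShift

/-! ### Coboundaries, and the oscillating sequences. -/

/-- Take `u` to be minus the mean of the first `n` Birkhoff sums: `S_i(T x) - S_i(x) = f (T^i x) - f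
x`, and averaging over `i` leaves `B_n - f`. -/
theorem sub_const_sub_coboundary_eq {X : Type*} (T : X → X) (f : X → ℝ) (c : ℝ) {n : ℕ} (hn : n ≠ 0)
    (x : X) : f x - c - (-((n : ℝ)⁻¹ * ∑ i ∈ Finset.range n, birkhoffSum T f i (T x)) -
      -((n : ℝ)⁻¹ * ∑ i ∈ Finset.range n, birkhoffSum T f i x)) =
      birkhoffAverage ℝ T f n x - c := by
  have h : ∑ i ∈ Finset.range n, birkhoffSum T f i (T x) -
      ∑ i ∈ Finset.range n, birkhoffSum T f i x = birkhoffSum T f n x - n * f x := by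
    rw [← Finset.sum_sub_distrib]
    simp_rw [birkhoffSum_apply_sub_birkhoffSum]
    simp [birkhoffSum]
  have hn' : (n : ℝ) ≠ 0 := by exact_mod_cast hn
  rw [birkhoffAverage, smul_eq_mul, show birkhoffSum T f n x =
    (∑ i ∈ Finset.range n, birkhoffSum T f i (T x) -
      ∑ i ∈ Finset.range n, birkhoffSum T f i x) + n * f x by linarith]
  field_simp
  ring

/-- If `f` is not cohomologous to a constant, its Birkhoff averages do not converge uniformly to
any constant. -/
theorem exists_le_abs_birkhoffAverage_sub {X : Type*} [TopologicalSpace X] {T : X → X} {f : X → ℝ}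
    (hT : Continuous T) (hf : Continuous f) (hcoh : ¬ CohomologousToConst T f) (c : ℝ) :
    ∃ η > 0, ∀ n₀ : ℕ, ∃ n ≥ n₀, ∃ z, η ≤ |birkhoffAverage ℝ T f n z - c| := by
  by_contra! h
  refine hcoh ⟨c, fun ε hε => ?_⟩
  obtain ⟨n₀, hn₀⟩ := h ε hε
  set n := n₀ + 1
  refine ⟨⟨fun x => -((n : ℝ)⁻¹ * ∑ i ∈ Finset.range n, birkhoffSum T f i x), ?_⟩, fun x => ?_⟩
  · unfold birkhoffSum
    exact (continuous_const.mul (continuous_finsetSum _ fun i _ =>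
      continuous_finsetSum _ fun j _ => hf.comp (hT.iterate j))).neg
  · simp only [ContinuousMap.coe_mk]
    rw [sub_const_sub_coboundary_eq T f c (Nat.succ_ne_zero n₀)]
    exact hn₀ n (Nat.le_succ _) x

theorem exists_frequently_iterate_cesaro {J : Set ℕ} (hJ : J.Infinite) (hJ' : Jᶜ.Infinite) {p : ℕ}
    (hp : 1 ≤ p) {e B : ℕ → ℝ} {α β M : ℝ} (hM : ∀ n, |e n| ≤ M) (hαβ : α < β)
    (hlo : ∀ q, Nat.log 2 (Nat.log 2 q) ∈ J → ∑ i ∈ Finset.range p, e (p * q + i) ≤ p * α)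
    (hhi : ∀ q, Nat.log 2 (Nat.log 2 q) ∉ J → p * β ≤ ∑ i ∈ Finset.range p, e (p * q + i))
    (hB : Tendsto (B - runningMean e) atTop (𝓝 0)) :
    ∃ α' β', α' < β' ∧ ∀ k, (∃ᶠ n in atTop, cesaro^[k] B n ≤ α') ∧
      ∃ᶠ n in atTop, β' ≤ cesaro^[k] B n := by
  -- On each side of `γ` two margins are spent: one in the window bound, one in passing from
  -- `runningMean e` to `B`.
  obtain ⟨γ, hγα, hγβ⟩ := exists_between hαβ
  obtain ⟨α', hα', hα'γ⟩ := exists_between hγα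
  obtain ⟨β', hγβ', hβ'⟩ := exists_between hγβ
  obtain ⟨α'', hα'', hαα''⟩ := exists_between hα'
  obtain ⟨β'', hββ'', hβ''⟩ := exists_between hβ'
  refine ⟨α', β', hα'γ.trans hγβ', fun k => ⟨?_, ?_⟩⟩
  · have h := tendsto_iterate_cesaro hB k
    rw [iterate_cesaro_sub] at h
    exact frequently_le_of_tendsto_sub h hαα''
      (frequently_iterate_cesaro_runningMean_le hJ hp hM (fun q _ => hlo q) hα'' k)
  · have hneg : runningMean (-e) = -runningMean e := by funext n; simp [runningMean]
    have hB' : Tendsto (-B - runningMean (-e)) atTop (𝓝 0) := by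
      rw [show -B - runningMean (-e) = -(B - runningMean e) by rw [hneg]; abel]
      have := hB.neg
      rwa [neg_zero] at this
    have h := tendsto_iterate_cesaro hB' k
    rw [iterate_cesaro_sub] at h
    have := frequently_le_of_tendsto_sub h (neg_lt_neg hββ'')
      (frequently_iterate_cesaro_runningMean_le (e := -e) (α := -β) hJ' hp
        (fun n => by simpa using hM n) (fun q _ hq => by
          have := hhi q hq
          simp only [Pi.neg_apply, Finset.sum_neg_distrib]
          linarith) (neg_lt_neg hβ'') k)
    rw [iterate_cesaro_neg] at this
    exact this.mono fun n hn => neg_le_neg_iff.1 hn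

/-- Edge effects: the last `r` terms, whose windows of length `r` leave `[a, b)`, only get the crude
bound `D`. -/
theorem abs_sum_Ico_le {d : ℕ → ℝ} {a b r : ℕ} {δ D : ℝ} (hab : a ≤ b) (hδ : 0 ≤ δ) (hD : 0 ≤ D)
    (hd : ∀ i, a ≤ i → i + r ≤ b → |d i| ≤ δ) (hd' : ∀ i, |d i| ≤ D) :
    |∑ i ∈ Finset.Ico a b, d i| ≤ (b - a : ℝ) * δ + r * D := by
  calc |∑ i ∈ Finset.Ico a b, d i| ≤ ∑ i ∈ Finset.Ico a b, |d i| := Finset.abs_sum_le_sum_abs _ _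
    _ ≤ ∑ i ∈ Finset.Ico a b, (δ + if b < i + r then D else 0) := by
        refine Finset.sum_le_sum fun i hi => ?_
        split_ifs with h
        · linarith [hd' i]
        · linarith [hd i (Finset.mem_Ico.1 hi).1 (not_lt.1 h)]
    _ = (b - a : ℝ) * δ + ((Finset.Ico a b).filter fun i => b < i + r).card * D := by
        rw [Finset.sum_add_distrib, ← Finset.sum_filter]
        simp [Nat.cast_sub hab]
    _ ≤ (b - a : ℝ) * δ + r * D := by
        gcongr
        calc ((Finset.Ico a b).filter fun i => b < i + r).card ≤ (Finset.Ico (b - r) b).card := by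
              refine Finset.card_le_card fun i hi => ?_
              simp only [Finset.mem_filter, Finset.mem_Ico] at hi ⊢
              lia
          _ ≤ r := by rw [Nat.card_Ico]; lia

section

variable {m : ℕ} [NeZero m] {f : (ℕ → Fin m) → ℝ} {F : Set ℕ} {w : ℕ → Fin m} {r : ℕ} {δ : ℝ}

theorem abs_integral_overwrite_sub_integral_le (hf : Continuous f)
    (hr : ∀ x y, (∀ i < r, x i = y i) → |f x - f y| < δ) {i : ℕ} (hi : ∀ j < r, i + j ∉ F) :
    |∫ x, f (leftShift^[i] (overwrite F w x)) ∂shiftMeasure m - ∫ x, f x ∂shiftMeasure m| ≤ δ := by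
  have hmp := measurePreserving_leftShift_iterate (m := m) i
  have h : ∫ x, f x ∂shiftMeasure m = ∫ x, f (leftShift^[i] x) ∂shiftMeasure m := by
    conv_lhs => rw [← hmp.map_eq]
    exact integral_map hmp.measurable.aemeasurable hf.measurable.aestronglyMeasurable
  have hint : Integrable (fun x => f (leftShift^[i] x)) (shiftMeasure m) :=
    integrable_of_continuous (hf.comp (continuous_leftShift.iterate i))
  rw [h, ← integral_sub (integrable_of_continuous (continuous_comp_overwrite hf F w i)) hint]
  refine abs_integral_le fun x => (hr _ _ fun j hj => ?_).le
  rw [leftShift_iterate_apply, leftShift_iterate_apply, add_comm, overwrite_of_notMem (hi j hj)]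

theorem abs_integral_overwrite_sub_le (hf : Continuous f)
    (hr : ∀ x y, (∀ i < r, x i = y i) → |f x - f y| < δ) {z : ℕ → Fin m} {i k : ℕ}
    (hi : ∀ j < r, i + j ∈ F ∧ w (i + j) = z (k + j)) :
    |∫ x, f (leftShift^[i] (overwrite F w x)) ∂shiftMeasure m - f (leftShift^[k] z)| ≤ δ := by
  have h : f (leftShift^[k] z) = ∫ _, f (leftShift^[k] z) ∂shiftMeasure m := by simp
  rw [h, ← integral_sub (integrable_of_continuous (continuous_comp_overwrite hf F w i))
    (integrable_const _)]
  refine abs_integral_le fun x => (hr _ _ fun j hj => ?_).le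
  rw [leftShift_iterate_apply, leftShift_iterate_apply, add_comm, overwrite_of_mem (hi j hj).1,
    (hi j hj).2, add_comm]

end

theorem infinite_setOf_even : {j : ℕ | Even j}.Infinite :=
  Set.infinite_of_forall_exists_gt fun n => ⟨2 * (n + 1), by simp, by lia⟩

theorem infinite_compl_setOf_even : {j : ℕ | Even j}ᶜ.Infinite :=
  Set.infinite_of_forall_exists_gt fun n => ⟨2 * n + 1, by simp, by lia⟩

theorem exists_overwrite_ae_isTypeB2 {m : ℕ} [NeZero m] {f : (ℕ → Fin m) → ℝ} (hf : Continuous f)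
    (hcoh : ¬ CohomologousToConst (leftShift (A := Fin m)) f) {K : ℕ} (hK : 0 < K) :
    ∃ (F : Set ℕ) (w : ℕ → Fin m) (l p : ℕ), (∀ i ∈ F, i % p < l) ∧
      (l / p : ℝ) = 1 / K ∧ ∀ᵐ x ∂shiftMeasure m, IsTypeB2 leftShift f (overwrite F w x) := by
  obtain ⟨M, hM⟩ := hf.exists_abs_le
  have hM0 : 0 ≤ M := (abs_nonneg _).trans (hM 0)
  set c := ∫ x, f x ∂shiftMeasure m with hc
  obtain ⟨η, hη, hlarge⟩ := exists_le_abs_birkhoffAverage_sub continuous_leftShift hf hcoh c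
  have hK' : (0 : ℝ) < K := by exact_mod_cast hK
  -- Chosen so that the approximation error over a whole block is `p * δ = l * η / 16`.
  set δ := η / (16 * K) with hδ
  have hδ0 : 0 < δ := by positivity
  obtain ⟨r, hr⟩ := hf.exists_forall_agree_abs_sub_lt hδ0
  -- The range `r` is fixed before `l`, so a long word makes the edge errors, at most `4 * M * r`,
  -- small against `l * η`.
  obtain ⟨l, hl, z, hz⟩ := hlarge (⌈32 * M * r / η⌉₊ + 1)
  have hl1 : 1 ≤ l := by lia
  have hl' : (0 : ℝ) < l := by exact_mod_cast hl1
  have hMr : 4 * M * r ≤ l * η / 8 := by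
    have h1 : 32 * M * r / η ≤ l := (Nat.le_ceil _).trans (by exact_mod_cast (by lia))
    rw [div_le_iff₀ hη] at h1
    linarith
  set p := l * K with hp
  have hp1 : 1 ≤ p := Nat.mul_pos hl1 hK
  have hlp : l ≤ p := Nat.le_mul_of_pos_right _ hK
  have hpc : (p : ℝ) = l * K := by rw [hp]; push_cast; ring
  have hpδ : p * δ = l * η / 16 := by rw [hpc, hδ]; field_simp
  set J : Set ℕ := {j | Even j}
  set F : Set ℕ := {i | Nat.log 2 (Nat.log 2 (i / p)) ∈ J ∧ i % p < l} with hF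
  set w : ℕ → Fin m := fun i => z (i % p) with hw
  set e : ℕ → ℝ := fun i => ∫ x, f (leftShift^[i] (overwrite F w x)) ∂shiftMeasure m with he
  have heM : ∀ i, |e i| ≤ M := fun i => abs_integral_le fun x => hM _
  have hdiv : ∀ q i, i < p → (p * q + i) / p = q := fun q i hi => by
    rw [Nat.mul_add_div hp1, Nat.div_eq_of_lt hi, add_zero]
  have hmod : ∀ q i, i < p → (p * q + i) % p = i := fun q i hi => by
    rw [Nat.mul_add_mod, Nat.mod_eq_of_lt hi]
  have hecM : ∀ i, |e i - c| ≤ 2 * M := fun i => by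
    have := abs_sub (e i) c; linarith [heM i, abs_integral_le hM]
  have hfree : ∀ q, Nat.log 2 (Nat.log 2 q) ∉ J →
      |∑ i ∈ Finset.range p, (e (p * q + i) - c)| ≤ l * η / 4 := by
    intro q hq
    have := abs_sum_Ico_le (d := fun i => e (p * q + i) - c) (r := r) (Nat.zero_le p) hδ0.le
      (show 0 ≤ 2 * M by positivity) (fun i _ hi => abs_integral_overwrite_sub_integral_le hf hr
        fun j hj hmem => hq (by
          have := hmem.1
          rwa [add_assoc, hdiv q (i + j) (by lia)] at this)) fun i => hecM _
    rw [← Finset.range_eq_Ico, Nat.cast_zero, sub_zero, hpδ] at this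
    have : 0 ≤ M * r := by positivity
    linarith
  have hforced : ∀ q, Nat.log 2 (Nat.log 2 q) ∈ J →
      |∑ i ∈ Finset.range p, (e (p * q + i) - c) - l * (birkhoffAverage ℝ leftShift f l z - c)| ≤
        l * η / 4 := by
    intro q hq
    have h1 := abs_sum_Ico_le (d := fun i => e (p * q + i) - c) (r := r) hlp hδ0.le
      (show 0 ≤ 2 * M by positivity) (fun i hi hi' => abs_integral_overwrite_sub_integral_le hf hr
        fun j hj hmem => by
          have := hmem.2
          rw [add_assoc, hmod q (i + j) (by lia)] at this
          lia) fun i => hecM _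
    have h2 := abs_sum_Ico_le (d := fun i => e (p * q + i) - f (leftShift^[i] z)) (r := r)
      (Nat.zero_le l) hδ0.le (show 0 ≤ 2 * M by positivity)
      (fun i _ hi => abs_integral_overwrite_sub_le hf hr fun j hj => by
        refine ⟨⟨?_, ?_⟩, ?_⟩
        · rwa [add_assoc, hdiv q (i + j) (by lia)]
        · rw [add_assoc, hmod q (i + j) (by lia)]; lia
        · simp only [hw]; rw [add_assoc, hmod q (i + j) (by lia)])
      fun i => by
        have := abs_sub (e (p * q + i)) (f (leftShift^[i] z))
        linarith [heM (p * q + i), hM (leftShift^[i] z)]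
    have h3 : l * birkhoffAverage ℝ leftShift f l z =
        ∑ i ∈ Finset.range l, f (leftShift^[i] z) := by
      rw [birkhoffAverage_eq_runningMean, runningMean, ← mul_assoc, mul_inv_cancel₀ hl'.ne',
        one_mul]
    have h4 : ∑ i ∈ Finset.range p, (e (p * q + i) - c) -
        l * (birkhoffAverage ℝ leftShift f l z - c) =
        ∑ i ∈ Finset.Ico l p, (e (p * q + i) - c) +
        ∑ i ∈ Finset.range l, (e (p * q + i) - f (leftShift^[i] z)) := by
      rw [mul_sub, h3, ← Finset.sum_range_add_sum_Ico _ hlp]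
      simp only [Finset.sum_sub_distrib, Finset.sum_const, Finset.card_range, nsmul_eq_mul]
      ring
    rw [h4]
    refine (abs_add_le _ _).trans ?_
    rw [← Finset.range_eq_Ico, Nat.cast_zero, sub_zero] at h2
    have : 0 ≤ M * r := by positivity
    linarith
  have hsum : ∀ q, ∑ i ∈ Finset.range p, e (p * q + i) =
      p * c + ∑ i ∈ Finset.range p, (e (p * q + i) - c) := fun q => by
    simp [Finset.sum_sub_distrib]
  set D := birkhoffAverage ℝ leftShift f l z - c
  have hmul : ∀ t : ℝ, p * (c + t * η / K) = p * c + t * (l * η) := fun t => by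
    rw [mul_add, hpc]; field_simp
  have hηK : 0 < η / K := by positivity
  refine ⟨F, w, l, p, fun i hi => hi.2, by rw [hpc]; field_simp, ?_⟩
  filter_upwards [ae_tendsto_birkhoffAverage_overwrite hf F w] with x hx
  have hBM : ∀ n, |birkhoffAverage ℝ leftShift f n (overwrite F w x)| ≤ M := fun n => by
    rw [birkhoffAverage_eq_runningMean]; exact abs_runningMean_le (fun i => hM _) n
  suffices h : ∃ α' β', α' < β' ∧ ∀ k,
      (∃ᶠ n in atTop, cesaro^[k] (fun n => birkhoffAverage ℝ leftShift f n (overwrite F w x)) n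
        ≤ α') ∧ ∃ᶠ n in atTop,
          β' ≤ cesaro^[k] (fun n => birkhoffAverage ℝ leftShift f n (overwrite F w x)) n by
    obtain ⟨α', β', hlt, h⟩ := h
    exact isTypeB2_of_frequently hBM hlt (fun k => (h k).1) fun k => (h k).2
  -- Free blocks have mean within `η / (4 * K)` of `c`, forced ones at least `3 * η / (4 * K)` away.
  -- The sign of `D` decides whether the forced blocks are the high or the low ones.
  rcases le_abs.1 hz with hD | hD
  · refine exists_frequently_iterate_cesaro (J := Jᶜ) (α := c + 1 / 4 * η / K)
      (β := c + 3 / 4 * η / K) infinite_compl_setOf_even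
      (by rw [compl_compl]; exact infinite_setOf_even) hp1 heM ?_ ?_ ?_ hx
    · have : 1 / 4 * η / K < 3 / 4 * η / K := by gcongr; norm_num
      linarith
    · intro q hq
      rw [hsum, hmul]
      linarith [(abs_le.1 (hfree q hq)).2]
    · intro q hq
      rw [hsum, hmul]
      have h1 : l * η ≤ l * D := by gcongr
      linarith [(abs_le.1 (hforced q (not_not.1 hq))).1]
  · refine exists_frequently_iterate_cesaro (J := J) (α := c + -(3 / 4) * η / K)
      (β := c + -(1 / 4) * η / K) infinite_setOf_even infinite_compl_setOf_even hp1 heM ?_ ?_ ?_ hx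
    · have : -(3 / 4) * η / K < -(1 / 4) * η / K := by gcongr; norm_num
      linarith
    · intro q hq
      rw [hsum, hmul]
      have h1 : l * η ≤ l * -D := by gcongr
      linarith [(abs_le.1 (hforced q hq)).2]
    · intro q hq
      rw [hsum, hmul]
      linarith [(abs_le.1 (hfree q hq)).1]

/-- Over the empty alphabet the shift space is empty and every function is trivially a coboundary.
-/
theorem neZero_of_not_cohomologousToConst {m : ℕ} {f : (ℕ → Fin m) → ℝ}
    (hcoh : ¬ CohomologousToConst (leftShift (A := Fin m)) f) : NeZero m := by
  refine ⟨fun hm => hcoh ?_⟩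
  subst hm
  exact ⟨0, fun ε _ => ⟨0, fun x => (x 0).elim0⟩⟩

theorem mainTheorem3 (m : ℕ) (f : (ℕ → Fin m) → ℝ) (hf : Continuous f)
    (hcoh : ¬ CohomologousToConst (leftShift (A := Fin m)) f) :
    bowenEntropy (leftShift (A := Fin m)) {x | IsTypeB2 leftShift f x} =
      ((Real.log (m : ℝ) : ℝ) : EReal) := by
  have := neZero_of_not_cohomologousToConst hcoh
  refine le_antisymm (bowenEntropy_le_log _) (log_le_bowenEntropy fun s hs hs' => ?_)
  have hlog : 0 < Real.log m := hs.trans hs'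
  -- With `K = k + 1`, the entropy lost to overwriting, `log m / K`, stays below `log m - s`.
  obtain ⟨k, hk⟩ := exists_nat_one_div_lt (div_pos (sub_pos.2 hs') hlog)
  obtain ⟨F, w, l, p, hF, hlp, hae⟩ := exists_overwrite_ae_isTypeB2 hf hcoh (Nat.succ_pos k)
  have hsle : s ≤ (1 - l / p) * Real.log m := by
    rw [hlp]
    rw [lt_div_iff₀ hlog] at hk
    push_cast
    linarith
  refine bowenMeasure_ne_zero_of_cylinder_le (μ := shiftMeasure m) (Φ := overwrite F w)
    ENNReal.ofReal_ne_top hs (shiftMeasure_preimage_cylinder_le hF hsle w) ?_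
  have h1 : shiftMeasure m (overwrite F w ⁻¹' {x | IsTypeB2 leftShift f x}) = 1 :=
    (measure_eq_measure_of_null_sdiff (subset_univ _) (by
      rw [← compl_eq_univ_sdiff]; exact hae)).trans measure_univ
  rw [h1]
  exact one_ne_zero
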